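/- \textbf{Setting.} All parameters are sequences indexed by the sample size $n$; $O,\Omega,\Theta,o,\omega$ refer to $n\to\infty$, $a_n=\mathrm{poly}(n)$ means $a_n=\Theta(n^D)$ and $a_n=\mathrm{polylog}(n)$ means $a_n=\Theta((\log n)^D)$, each for some constant $D>0$. Fix $q\ge 3$ and $\beta_1,\beta_2\in[0,1)$ with $\beta_1^2<\beta_2$. \emph{Data.} Let $\mathbf v=(1,0,\dots,0)\in\mathbb R^d$. A data point has a uniform label $y\in\{\pm1\}$ and two patches $\mathbf x_1,\mathbf x_2\in\mathbb R^d$: in uniformly random order they are the signal patch $y\mathbf v$ and the noise patch $\boldsymbol\xi=\mathbf b\odot\mathbf z-\alpha y\mathbf v$, where $\mathbf z\sim N(0,\sigma_p^2 I_d)$ and $\mathbf b\in\{0,1\}^d$ is the indicator of a uniformly random $s$-element subset of the coordinates $2,\dots,d$ (all choices independent). Here $d=\mathrm{poly}(n)$, $s=\Theta(d^{1/2}/n^2)$, $\sigma_p^2=\Theta(1/(s\,\mathrm{polylog}(n)))$, $\alpha=\Theta(\sigma_p\,\mathrm{polylog}(n))$, $\sigma_p>0$, $\alpha\in(0,1)$.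 The training set consists of $n$ independent data points. \emph{Network.} With $\sigma(x)=\max(x,0)^q$ and $m=\mathrm{polylog}(n)$, put $F_j(\mathbf W,\mathbf x)=\sum_{r=1}^m[\sigma(\langle\mathbf w_{j,r},\mathbf x_1\rangle)+\sigma(\langle\mathbf w_{j,r},\mathbf x_2\rangle)]$ for $j\in\{\pm1\}$, and $L_i(\mathbf W)=-\log\bigl(e^{F_{y_i}(\mathbf W,\mathbf x_i)}/\sum_{j}e^{F_j(\mathbf W,\mathbf x_i)}\bigr)$. The initial weights are independent, $\mathbf w^{(0)}_{j,r}\sim N(0,\sigma_0^2I_d)$, and independent of the data, with $\sigma_0>0$, $\sigma_0=\Theta(d^{-1/4})$. \emph{Adam.} With batches $\mathcal I_t\subseteq\{1,\dots,n\}$ of size $B$, $1\le B\le n$, put $g^{(t)}_{j,r}=\frac1B\sum_{i\in\mathcal I_t}\nabla_{\mathbf w_{j,r}}L_i(\mathbf W^{(t)})+\lambda\mathbf w_{j,r}^{(t)}$ and, entrywise, starting from $\mathbf m^{(0)}_{j,r}=\mathbf u^{(0)}_{j,r}=0$, $$\mathbf m^{(t+1)}_{j,r}=\beta_1\mathbf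 m^{(t)}_{j,r}+(1-\beta_1)g^{(t)}_{j,r},\quad \mathbf u^{(t+1)}_{j,r}=\beta_2\mathbf u^{(t)}_{j,r}+(1-\beta_2)(g^{(t)}_{j,r})^2,\quad \mathbf w^{(t+1)}_{j,r}=\mathbf w^{(t)}_{j,r}-\eta\,\frac{\mathbf m^{(t)}_{j,r}}{\sqrt{\mathbf u^{(t)}_{j,r}}+\epsilon}.$$ Here $\lambda,\eta,\epsilon>0$, $\epsilon=\Theta(\lambda\eta)$, $\eta=1/\mathrm{poly}(n)$ with $\eta=o\bigl(\min(\lambda,1)\,\sigma_0^q\sigma_p^q\bigr)$, and training runs for $T=\mathrm{poly}(n)/\eta$ epochs of $\lceil n/B\rceil$ iterations each. The batch size is either large, $n/B=\Theta(1)$, or small, $n/B\ge c\log(1/\epsilon)$ for some constant $c>0$ and all large $n$. \textbf{Corollary (Effective weight decay in Adam).} There is a constant $A$ depending only on $q$ such that, if $\lambda=\omega\bigl(\sigma_0^{q-2}(\log n)^A\bigr)$, then training is stuck at initialisation: there are constants $C,D$ such that for all sufficiently large $n$, with probability at least $1-1/n$ over the training set and the initialisation, for every choice of the batches, for all iterations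 $t\le T\lceil n/B\rceil$, all $j\in\{\pm1\}$, $r\le m$ and $i\le n$, $$\bigl|\langle\mathbf w^{(t)}_{j,r},j\mathbf v\rangle\bigr|\le C(\log n)^D\,\sigma_0,\qquad \bigl|\langle\mathbf w^{(t)}_{j,r},\boldsymbol\xi_i\rangle\bigr|\le C(\log n)^D\,s^{1/2}\sigma_p\sigma_0 .$$ -/

import Mathlib

open MeasureTheory ProbabilityTheory Filter Asymptotics

/-- `a n = poly(n)`: `a n = Θ(n ^ D)` for some constant `D > 0`. -/
def IsPolyGrowth (a : ℕ → ℝ) : Prop :=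
  ∃ D : ℝ, 0 < D ∧ a =Θ[atTop] fun n : ℕ => (n : ℝ) ^ D

/-- `a n = polylog(n)`: `a n = Θ((log n) ^ D)` for some constant `D > 0`. -/
def IsPolylogGrowth (a : ℕ → ℝ) : Prop :=
  ∃ D : ℝ, 0 < D ∧ a =Θ[atTop] fun n : ℕ => Real.log n ^ D

/-- The parameters of the data model, of the network and of the optimizer, for one sample size:
dimension `d`, noise sparsity `s`, width `m`, batch size `B`, number of epochs `T`, noise level
`σp`, feature-noise strength `α`, initialization scale `σ₀`, learning rate `η`, weight decay `lam`
and stability constant `ε`. -/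
structure Params where
  d : ℕ
  s : ℕ
  m : ℕ
  B : ℕ
  T : ℕ
  σp : ℝ
  α : ℝ
  σ₀ : ℝ
  η : ℝ
  lam : ℝ
  ε : ℝ

/-! ### The data model -/

instance : MeasurableSingletonClass ℤˣ :=
  ⟨fun x => ⟨{(x : ℤ)}, MeasurableSet.singleton _, by ext y; simp [Units.val_inj]⟩⟩

/-- The real number `1` or `-1` attached to a sign. -/
def signVal (y : ℤˣ) : ℝ := ((y : ℤ) : ℝ)

/-- The feature vector `v = (1, 0, …, 0)`. -/
def feature (d : ℕ) : Fin d → ℝ := fun k => if (k : ℕ) = 0 then 1 else 0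

/-- The independent randomness behind one data point: the label, the choice of the signal patch,
the binary mask of the noise coordinates, and the Gaussian vector before masking. -/
abbrev Draw (d : ℕ) : Type := ℤˣ × Bool × (Fin d → Bool) × (Fin d → ℝ)

/-- The binary masks with exactly `s` ones, none of them at the feature coordinate. -/
def noiseMasks (d s : ℕ) : Set (Fin d → Bool) :=
  {b | (∀ k : Fin d, (k : ℕ) = 0 → b k = false) ∧
    (Finset.univ.filter fun k : Fin d => b k = true).card = s}

/-- The isotropic Gaussian law `N(0, σ² I_d)`. -/
noncomputable def isoGaussian (d : ℕ) (σ : ℝ) : Measure (Fin d → ℝ) :=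
  Measure.pi fun _ : Fin d => gaussianReal 0 (Real.toNNReal (σ ^ 2))

/-- The law of one draw: uniform label, uniform patch order, uniform mask, Gaussian vector, all
independent. -/
noncomputable def drawLaw (d s : ℕ) (σp : ℝ) : Measure (Draw d) :=
  (uniformOn (Set.univ : Set ℤˣ)).prod ((uniformOn (Set.univ : Set Bool)).prod
    ((uniformOn (noiseMasks d s)).prod (isoGaussian d σp)))

/-- The label `y`. -/
def Draw.label {d : ℕ} (ω : Draw d) : ℤˣ := ω.1

/-- The signal patch `y v`. -/
def Draw.signal {d : ℕ} (ω : Draw d) : Fin d → ℝ := fun k => signVal ω.label * feature d k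

/-- The noise patch `ξ`: the masked Gaussian vector minus `α y v`. -/
def Draw.noise {d : ℕ} (α : ℝ) (ω : Draw d) : Fin d → ℝ := fun k =>
  (if ω.2.2.1 k then ω.2.2.2 k else 0) - α * signVal ω.label * feature d k

/-- The first patch `x₁`. -/
def Draw.patch₁ {d : ℕ} (α : ℝ) (ω : Draw d) : Fin d → ℝ :=
  if ω.2.1 then ω.signal else ω.noise α

/-- The second patch `x₂`. -/
def Draw.patch₂ {d : ℕ} (α : ℝ) (ω : Draw d) : Fin d → ℝ :=
  if ω.2.1 then ω.noise α else ω.signal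

/-! ### The two-layer network and its loss -/

/-- The weights `w_{j,r}[k]`, for `j = ±1`, `r < m`, `k < d`. -/
abbrev Weights (m d : ℕ) : Type := ℤˣ → Fin m → Fin d → ℝ

/-- The activation `σ(x) = max(x, 0) ^ q`. -/
noncomputable def activation (q x : ℝ) : ℝ := max x 0 ^ q

/-- The `j`-th output `F_j(W, x)` of the network on the input with patches `x₁`, `x₂`. -/
noncomputable def netOutput {m d : ℕ} (q : ℝ) (W : Weights m d) (x₁ x₂ : Fin d → ℝ)
    (j : ℤˣ) : ℝ :=
  ∑ r : Fin m, (activation q (W j r ⬝ᵥ x₁) + activation q (W j r ⬝ᵥ x₂))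

/-- The cross-entropy loss of one data point. -/
noncomputable def sampleLoss {m d : ℕ} (q α : ℝ) (ω : Draw d) (W : Weights m d) : ℝ :=
  -Real.log (Real.exp (netOutput q W (ω.patch₁ α) (ω.patch₂ α) ω.label) /
    ∑ j : ℤˣ, Real.exp (netOutput q W (ω.patch₁ α) (ω.patch₂ α) j))

/-- The weights `W` with the entry `w_{j,r}[k]` replaced by `z`. -/
def Weights.setEntry {m d : ℕ} (W : Weights m d) (j : ℤˣ) (r : Fin m) (k : Fin d) (z : ℝ) :
    Weights m d :=
  Function.update W j (Function.update (W j) r (Function.update (W j r) k z))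

/-- The partial derivative of `f` with respect to the entry `w_{j,r}[k]`, at `W`. -/
noncomputable def partialDeriv {m d : ℕ} (f : Weights m d → ℝ) (W : Weights m d)
    (j : ℤˣ) (r : Fin m) (k : Fin d) : ℝ :=
  deriv (fun z : ℝ => f (W.setEntry j r k z)) (W j r k)

/-! ### Stochastic Adam with weight decay in the loss -/

/-- The stochastic gradient on the batch `I`:
`(1/B) ∑_{i ∈ I} ∇L_i(W) + λ W`, entry by entry. -/
noncomputable def stochGrad (q : ℝ) {n : ℕ} (p : Params) (S : Fin n → Draw p.d)
    (I : Finset (Fin n)) (W : Weights p.m p.d) : Weights p.m p.d := fun j r k =>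
  (1 / (p.B : ℝ)) * ∑ i ∈ I, partialDeriv (sampleLoss q p.α (S i)) W j r k + p.lam * W j r k

/-- The state of Adam: weights, first moment estimate, second moment estimate. -/
structure AdamState (m d : ℕ) where
  w : Weights m d
  mom₁ : Weights m d
  mom₂ : Weights m d

/-- The state of Adam after `t` iterations from the initialization `W₀`, on the training set `S`,
with the batch `I t` in iteration `t`. All operations are entrywise. -/
noncomputable def adam (q β₁ β₂ : ℝ) {n : ℕ} (p : Params) (S : Fin n → Draw p.d)
    (I : ℕ → Finset (Fin n)) (W₀ : Weights p.m p.d) : ℕ → AdamState p.m p.d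
  | 0 => ⟨W₀, fun _ _ _ => 0, fun _ _ _ => 0⟩
  | t + 1 =>
    let A := adam q β₁ β₂ p S I W₀ t
    let g := stochGrad q p S (I t) A.w
    { w := fun j r k => A.w j r k - p.η * (A.mom₁ j r k / (Real.sqrt (A.mom₂ j r k) + p.ε))
      mom₁ := fun j r k => β₁ * A.mom₁ j r k + (1 - β₁) * g j r k
      mom₂ := fun j r k => β₂ * A.mom₂ j r k + (1 - β₂) * g j r k ^ 2 }

/-- The joint law of the training set (`n` independent draws) and of the Gaussian initialization,
independent of each other. -/
noncomputable def trainLaw (n : ℕ) (p : Params) :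
    Measure ((Fin n → Draw p.d) × Weights p.m p.d) :=
  (Measure.pi fun _ : Fin n => drawLaw p.d p.s p.σp).prod
    (Measure.pi fun _ : ℤˣ => Measure.pi fun _ : Fin p.m => isoGaussian p.d p.σ₀)

/-- The number of iterations in `T` epochs of `⌈n/B⌉` iterations each. -/
noncomputable def numIters (n : ℕ) (p : Params) : ℕ := p.T * ⌈(n : ℝ) / p.B⌉₊

/-! ### The asymptotic regime -/

/-- The conditions on the parameters as the sample size `n` tends to infinity, except for the one
on the size of the weight decay. -/
structure AdamRegime (q : ℝ) (P : ℕ → Params) : Prop where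
  pos : ∀ᶠ n in atTop, 0 < (P n).σp ∧ 0 < (P n).α ∧ (P n).α < 1 ∧ 0 < (P n).σ₀ ∧
    0 < (P n).η ∧ 0 < (P n).lam ∧ 0 < (P n).ε
  d_poly : IsPolyGrowth fun n => ((P n).d : ℝ)
  s_theta : (fun n => ((P n).s : ℝ)) =Θ[atTop]
    fun n : ℕ => ((P n).d : ℝ) ^ (1 / 2 : ℝ) / (n : ℝ) ^ 2
  σp_theta : ∃ a : ℕ → ℝ, IsPolylogGrowth a ∧
    (fun n => (P n).σp ^ 2) =Θ[atTop] fun n => 1 / (((P n).s : ℝ) * a n)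
  α_theta : ∃ a : ℕ → ℝ, IsPolylogGrowth a ∧
    (fun n => (P n).α) =Θ[atTop] fun n => (P n).σp * a n
  σ₀_theta : (fun n => (P n).σ₀) =Θ[atTop] fun n => ((P n).d : ℝ) ^ (-(1 / 4) : ℝ)
  m_polylog : IsPolylogGrowth fun n => ((P n).m : ℝ)
  η_inv_poly : IsPolyGrowth fun n => 1 / (P n).η
  η_small : (fun n => (P n).η) =o[atTop]
    fun n => min (P n).lam 1 * (P n).σ₀ ^ q * (P n).σp ^ q
  ε_theta : (fun n => (P n).ε) =Θ[atTop] fun n => (P n).lam * (P n).η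
  T_poly : IsPolyGrowth fun n => ((P n).T : ℝ) * (P n).η
  B_range : ∀ᶠ n in atTop, 1 ≤ (P n).B ∧ (P n).B ≤ n
  /-- Large batches, `n/B = Θ(1)`, or small batches, `n/B ≥ Θ(log(1/ε))`. -/
  B_size : ((fun n : ℕ => (n : ℝ) / (P n).B) =Θ[atTop] fun _ : ℕ => (1 : ℝ)) ∨
    ∃ c : ℝ, 0 < c ∧ ∀ᶠ n : ℕ in atTop, c * Real.log (1 / (P n).ε) ≤ (n : ℝ) / (P n).B

/-!
Divided by the weight decay `lam`, the gradient of one weight is `w + h`, where `h` is the data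
gradient over `lam`, and the stability constant becomes `ε / lam = Θ(η)`. At the scale of the
initialization, `h` is at most `σ₀` in the feature coordinate and at most `σ₀ σp` in the others
(`GoodEvent.abs_relGrad_le`); this is where `lam ≫ σ₀ ^ (q - 2) polylog(n)` enters.

Every coordinate is thus an instance of a scalar recursion (`ScalarAdam`) driven by `w + h` with `h`,
`η` and the stability constant bounded by some `R`. As `β₁² < β₂`, one step moves the weight by
`O(η)` (`ScalarAdam.abs_step_le`), so both moment estimates are averages of an almost constant
gradient: `m t = (1 - β₁ᵗ) w t + O(R)` and `√(u t) = √(1 - β₂ᵗ) |w t| + O(R)`. Hence the step is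
`η (1 - β₁ᵗ) / √(1 - β₂ᵗ)` towards `0`, with relative error `O(R / |w t|)`, as long as `|w t|`
dominates `R`; the errors sum up to `O(R log (|w 0| / |w t|))`, and below the scale of `R` the weight
stays there. So `w t` is, up to `O(R)` times a logarithm, the soft thresholding of `w 0` at a
level that depends on `t` alone (`exists_tracking`).

For a noise vector `ξ` with `s` nonzero noise coordinates this gives `⟨w t, ξ⟩` as the inner product
of `ξ` with the soft-thresholded initial weights plus an error of order `s σp R` with `R = σ₀ σp`,
which is `O(√s σp σ₀)` since `√s σp ≤ 1`. The main term is a Gaussian linear form given the initial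
weights and the mask, because the thresholding level does not depend on the data; it is of the order
`√s σp σ₀ polylog(n)` outside an event of probability `exp (-(log n)² / 2)`, which leaves room for a
union bound over the polynomially many iterations (`trainLaw_not_goodEvent_le`). On the good event,
the bounds on the weights and on `h` imply each other by induction over time (`exists_stuck`),
for every choice of the batches.
-/

/-! ### One coordinate of Adam: the moment estimates -/

/-- Soft thresholding at level `c ≥ 0`: the value moves towards `0` by `c` and stops there. -/
noncomputable def softThreshold (c x : ℝ) : ℝ := max (x - c) 0 - max (-x - c) 0

theorem softThreshold_neg (c x : ℝ) : softThreshold c (-x) = -softThreshold c x := by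
  simp [softThreshold]

theorem softThreshold_of_nonneg {c x : ℝ} (hc : 0 ≤ c) (hx : 0 ≤ x) :
    softThreshold c x = max (x - c) 0 := by
  rw [softThreshold, max_eq_right (by linarith : -x - c ≤ 0), sub_zero]

theorem abs_softThreshold_le {c : ℝ} (hc : 0 ≤ c) (x : ℝ) : |softThreshold c x| ≤ |x| := by
  rcases le_total 0 x with hx | hx
  · rw [softThreshold_of_nonneg hc hx, abs_of_nonneg (le_max_right _ _), abs_of_nonneg hx]
    exact max_le (by linarith) hx
  · have h := softThreshold_of_nonneg hc (neg_nonneg.2 hx)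
    rw [softThreshold_neg] at h
    rw [← abs_neg, h, abs_of_nonneg (le_max_right _ _), abs_of_nonpos hx]
    exact max_le (by linarith) (by linarith)

/-- The ratio `(1 - β₁ᵗ) / √(1 - β₂ᵗ)` of the bias factors of the two moment estimates: the length,
in units of the learning rate, of the step that Adam makes at time `t` when its gradients have been
constant. At `t = 0` it is `0 / 0 = 0`, which agrees with Adam's first step being zero. -/
noncomputable def biasRatio (β₁ β₂ : ℝ) (t : ℕ) : ℝ := (1 - β₁ ^ t) / Real.sqrt (1 - β₂ ^ t)

/-- The distance travelled up to time `t` by a weight of Adam with constant gradients. -/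
noncomputable def travel (β₁ β₂ η : ℝ) (t : ℕ) : ℝ :=
  ∑ τ ∈ Finset.range t, η * biasRatio β₁ β₂ τ

/-- One coordinate of Adam whose gradient is `w t + h t`: the pull `w t` of the weight
decay plus a perturbation `h t`. -/
structure ScalarAdam (β₁ β₂ η ε : ℝ) (w m u h : ℕ → ℝ) : Prop where
  m_zero : m 0 = 0
  u_zero : u 0 = 0
  m_succ : ∀ t, m (t + 1) = β₁ * m t + (1 - β₁) * (w t + h t)
  u_succ : ∀ t, u (t + 1) = β₂ * u t + (1 - β₂) * (w t + h t) ^ 2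
  w_succ : ∀ t, w (t + 1) = w t - η * (m t / (Real.sqrt (u t) + ε))

/-- A bound on `|m| / √u`, and so on the length of one step in units of the learning rate: the
square root of the constant in the Cauchy–Schwarz inequality `m² ≤ C u`. -/
noncomputable def stepBound (β₁ β₂ : ℝ) : ℝ :=
  Real.sqrt ((1 - β₁) ^ 2 / ((1 - β₂) * (1 - β₁ ^ 2 / β₂)))

section
variable {β₁ β₂ η ε R : ℝ} {w m u h : ℕ → ℝ}

theorem biasRatio_nonneg (h1 : 0 ≤ β₁) (h1' : β₁ < 1) (t : ℕ) : 0 ≤ biasRatio β₁ β₂ t :=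
  div_nonneg (sub_nonneg.2 (pow_le_one₀ h1 h1'.le)) (Real.sqrt_nonneg _)

theorem travel_nonneg (h1 : 0 ≤ β₁) (h1' : β₁ < 1) (hη : 0 < η) (t : ℕ) :
    0 ≤ travel β₁ β₂ η t :=
  Finset.sum_nonneg fun _ _ => mul_nonneg hη.le (biasRatio_nonneg h1 h1' _)

theorem travel_succ (t : ℕ) :
    travel β₁ β₂ η (t + 1) = travel β₁ β₂ η t + η * biasRatio β₁ β₂ t :=
  Finset.sum_range_succ _ _

theorem ScalarAdam.u_nonneg (H : ScalarAdam β₁ β₂ η ε w m u h) (h2 : 0 ≤ β₂) (h2' : β₂ < 1)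
    (t : ℕ) : 0 ≤ u t := by
  induction t with
  | zero => exact H.u_zero.ge
  | succ t ih =>
    rw [H.u_succ]
    have : 0 ≤ 1 - β₂ := by linarith
    positivity

/-- The Cauchy–Schwarz bound `m² ≤ C u`. It holds because the weights `β₁ⁱ` of the first moment are
square-summable against the inverses of the weights `β₂ⁱ` of the second one. -/
theorem ScalarAdam.sq_m_le (H : ScalarAdam β₁ β₂ η ε w m u h) (h2 : 0 < β₂)
    (h2' : β₂ < 1) (hβ : β₁ ^ 2 < β₂) (t : ℕ) :
    m t ^ 2 ≤ (1 - β₁) ^ 2 / ((1 - β₂) * (1 - β₁ ^ 2 / β₂)) * u t := by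
  set K := (1 - β₁) ^ 2 / ((1 - β₂) * (1 - β₁ ^ 2 / β₂)) with hK
  have hq : β₁ ^ 2 / β₂ < 1 := (div_lt_one h2).2 hβ
  have hp : 0 < (1 - β₂) * (1 - β₁ ^ 2 / β₂) := mul_pos (by linarith) (by linarith)
  have hid : K * (1 - β₁ ^ 2 / β₂) = (1 - β₁) ^ 2 / (1 - β₂) := by
    rw [hK]
    have : 1 - β₁ ^ 2 / β₂ ≠ 0 := by linarith
    have : 1 - β₂ ≠ 0 := by linarith
    have : β₂ - β₁ ^ 2 ≠ 0 := by linarith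
    field_simp
  induction t with
  | zero => simp [H.m_zero, H.u_zero]
  | succ t ih =>
    rw [H.m_succ, H.u_succ]
    set g := w t + h t
    have hu := H.u_nonneg h2.le h2' t
    have h2s : 0 < 1 - β₂ := by linarith
    -- weighted Cauchy–Schwarz `(x + y)² ≤ (x² / p + y² / q)` scaled to the two moments
    have e1 : (β₁ * m t + (1 - β₁) * g) ^ 2 ≤
        (β₁ ^ 2 / β₂ * K + (1 - β₁) ^ 2 / (1 - β₂)) * (β₂ * u t + (1 - β₂) * g ^ 2) := by
      set M := m t
      set U := u t
      have hK0 : 0 ≤ K := div_nonneg (sq_nonneg _) hp.le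
      have e2 : (β₁ ^ 2 / β₂ * K + (1 - β₁) ^ 2 / (1 - β₂)) * (β₂ * U + (1 - β₂) * g ^ 2)
          = β₁ ^ 2 * (K * U) + (1 - β₁) ^ 2 * g ^ 2 +
            (K * β₁ ^ 2 * g ^ 2 * ((1 - β₂) / β₂) + (1 - β₁) ^ 2 * U * (β₂ / (1 - β₂))) := by
        field_simp
        ring
      rw [e2]
      have e3 : 2 * (β₁ * M) * ((1 - β₁) * g) ≤
          K * β₁ ^ 2 * g ^ 2 * ((1 - β₂) / β₂) + (1 - β₁) ^ 2 * U * (β₂ / (1 - β₂)) := by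
        set x := (1 - β₂) / β₂ with hx
        have hx0 : 0 < x := by positivity
        have hxi : β₂ / (1 - β₂) = x⁻¹ := by rw [hx, inv_div]
        rw [hxi]
        have hprod : (K * β₁ ^ 2 * g ^ 2 * x) * ((1 - β₁) ^ 2 * U * x⁻¹) =
            β₁ ^ 2 * g ^ 2 * (1 - β₁) ^ 2 * (K * U) := by
          field_simp
        have hsq : (β₁ * M * ((1 - β₁) * g)) ^ 2 ≤
            (K * β₁ ^ 2 * g ^ 2 * x) * ((1 - β₁) ^ 2 * U * x⁻¹) := by
          rw [hprod]
          calc _ = β₁ ^ 2 * g ^ 2 * (1 - β₁) ^ 2 * M ^ 2 := by ring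
            _ ≤ _ := by gcongr
        set a := K * β₁ ^ 2 * g ^ 2 * x
        set b := (1 - β₁) ^ 2 * U * x⁻¹
        have ha : 0 ≤ a := by positivity
        have hb : 0 ≤ b := by positivity
        have : (2 * (β₁ * M * ((1 - β₁) * g))) ^ 2 ≤ (a + b) ^ 2 := by
          nlinarith [sq_nonneg (a - b)]
        have := abs_le_of_sq_le_sq this (by positivity)
        linarith [le_of_abs_le this]
      have : β₁ ^ 2 * M ^ 2 ≤ β₁ ^ 2 * (K * U) := by gcongr
      nlinarith
    refine e1.trans (le_of_eq ?_)
    rw [← hid]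
    ring

theorem ScalarAdam.abs_m_le (H : ScalarAdam β₁ β₂ η ε w m u h) (h2 : 0 < β₂)
    (h2' : β₂ < 1) (hβ : β₁ ^ 2 < β₂) (t : ℕ) :
    |m t| ≤ stepBound β₁ β₂ * Real.sqrt (u t) := by
  rw [stepBound, ← Real.sqrt_mul' _ (H.u_nonneg h2.le h2' t)]
  exact Real.abs_le_sqrt (H.sq_m_le h2 h2' hβ t)

theorem ScalarAdam.abs_step_le (H : ScalarAdam β₁ β₂ η ε w m u h) (h2 : 0 < β₂)
    (h2' : β₂ < 1) (hβ : β₁ ^ 2 < β₂) (hε : 0 < ε) (t : ℕ) :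
    |m t / (Real.sqrt (u t) + ε)| ≤ stepBound β₁ β₂ := by
  have hs := Real.sqrt_nonneg (u t)
  have hC : 0 ≤ stepBound β₁ β₂ := Real.sqrt_nonneg _
  rw [abs_div, abs_of_pos (by linarith : 0 < Real.sqrt (u t) + ε), div_le_iff₀ (by linarith)]
  nlinarith [H.abs_m_le h2 h2' hβ t]

theorem ScalarAdam.abs_w_succ_sub_le (H : ScalarAdam β₁ β₂ η ε w m u h) (h2 : 0 < β₂)
    (h2' : β₂ < 1) (hβ : β₁ ^ 2 < β₂) (hε : 0 < ε) (hη : 0 < η) (hηR : η ≤ R) (t : ℕ) :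
    |w t - w (t + 1)| ≤ stepBound β₁ β₂ * R := by
  rw [H.w_succ, sub_sub_cancel, abs_mul, abs_of_pos hη, mul_comm]
  exact mul_le_mul (H.abs_step_le h2 h2' hβ hε t) hηR hη.le (Real.sqrt_nonneg _)

/-- Since the weight moves slowly, the first moment estimate is the current weight times its bias
factor, up to the size of the perturbation. -/
theorem ScalarAdam.abs_m_sub_le (H : ScalarAdam β₁ β₂ η ε w m u h) (h1 : 0 ≤ β₁) (h1' : β₁ < 1)
    (h2 : 0 < β₂) (h2' : β₂ < 1) (hβ : β₁ ^ 2 < β₂) (hε : 0 < ε) (hη : 0 < η) (hηR : η ≤ R)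
    {N : ℕ} (hh : ∀ τ < N, |h τ| ≤ R) (t : ℕ) (ht : t ≤ N) :
    |m t - (1 - β₁ ^ t) * w t| ≤ (1 + stepBound β₁ β₂ / (1 - β₁)) * R := by
  have hC : 0 ≤ stepBound β₁ β₂ := Real.sqrt_nonneg _
  have hR : 0 < R := hη.trans_le hηR
  have h1s : 0 < 1 - β₁ := by linarith
  induction t with
  | zero =>
    simp only [H.m_zero, pow_zero, sub_self, zero_mul, abs_zero]
    positivity
  | succ t ih =>
    have ih := ih (by omega)
    have hw := H.abs_w_succ_sub_le h2 h2' hβ hε hη hηR t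
    have hht := hh t (by omega)
    have hp : 0 ≤ 1 - β₁ ^ (t + 1) := sub_nonneg.2 (pow_le_one₀ h1 h1'.le)
    have hp' : 1 - β₁ ^ (t + 1) ≤ 1 := by linarith [pow_nonneg h1 (t + 1)]
    have e : m (t + 1) - (1 - β₁ ^ (t + 1)) * w (t + 1) =
        β₁ * (m t - (1 - β₁ ^ t) * w t) + (1 - β₁) * h t +
          (1 - β₁ ^ (t + 1)) * (w t - w (t + 1)) := by
      rw [H.m_succ]; ring
    rw [e]
    calc _ ≤ |β₁ * (m t - (1 - β₁ ^ t) * w t)| + |(1 - β₁) * h t| +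
          |(1 - β₁ ^ (t + 1)) * (w t - w (t + 1))| := abs_add_three _ _ _
      _ ≤ β₁ * ((1 + stepBound β₁ β₂ / (1 - β₁)) * R) + (1 - β₁) * R +
          1 * (stepBound β₁ β₂ * R) := by
        rw [abs_mul, abs_mul, abs_mul, abs_of_nonneg h1, abs_of_pos h1s, abs_of_nonneg hp]
        gcongr
      _ = _ := by field_simp; ring

/-- The reverse triangle inequality for the Euclidean norm of the plane. -/
theorem abs_sqrt_sub_sqrt_le (a b c d : ℝ) :
    |Real.sqrt (a ^ 2 + b ^ 2) - Real.sqrt (c ^ 2 + d ^ 2)| ≤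
      Real.sqrt ((a - c) ^ 2 + (b - d) ^ 2) := by
  have h := abs_norm_sub_norm_le (⟨a, b⟩ : ℂ) ⟨c, d⟩
  have e : ∀ x y : ℝ, ‖(⟨x, y⟩ : ℂ)‖ = Real.sqrt (x ^ 2 + y ^ 2) := fun x y => by
    rw [Complex.norm_def, Complex.normSq_mk]; congr 1; ring
  rw [e, e] at h
  refine h.trans (le_of_eq ?_)
  rw [← e]
  congr 1

/-- The companion of `ScalarAdam.abs_m_sub_le` for the second moment estimate. -/
theorem ScalarAdam.abs_sqrt_u_sub_le (H : ScalarAdam β₁ β₂ η ε w m u h)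
    (h2 : 0 < β₂) (h2' : β₂ < 1) (hβ : β₁ ^ 2 < β₂) (hε : 0 < ε) (hη : 0 < η) (hηR : η ≤ R)
    {N : ℕ} (hh : ∀ τ < N, |h τ| ≤ R) (t : ℕ) (ht : t ≤ N) :
    |Real.sqrt (u t) - Real.sqrt (1 - β₂ ^ t) * (|w t|)| ≤
      (1 + stepBound β₁ β₂ / (1 - Real.sqrt β₂)) * R := by
  have hC : 0 ≤ stepBound β₁ β₂ := Real.sqrt_nonneg _
  have hR : 0 < R := hη.trans_le hηR
  have h2s : 0 < 1 - β₂ := by linarith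
  set r := Real.sqrt β₂ with hr
  have hr0 : 0 < r := Real.sqrt_pos.2 h2
  have hr1 : r < 1 := by rw [hr, Real.sqrt_lt' one_pos]; simpa using h2'
  have hrr : r ^ 2 = β₂ := Real.sq_sqrt h2.le
  have hr1s : 0 < 1 - r := by linarith
  induction t with
  | zero =>
    simp only [H.u_zero, pow_zero, sub_self, Real.sqrt_zero, zero_mul, abs_zero]
    positivity
  | succ t ih =>
    have ih := ih (by omega)
    have hw := H.abs_w_succ_sub_le h2 h2' hβ hε hη hηR t
    have hht := hh t (by omega)
    have hu := H.u_nonneg h2.le h2' t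
    have hp : 0 ≤ 1 - β₂ ^ t := sub_nonneg.2 (pow_le_one₀ h2.le h2'.le)
    have hp' : 0 ≤ 1 - β₂ ^ (t + 1) := sub_nonneg.2 (pow_le_one₀ h2.le h2'.le)
    set c := stepBound β₁ β₂ / (1 - r) with hc
    have hc0 : 0 ≤ c := by positivity
    have hcC : c * (1 - r) = stepBound β₁ β₂ := by rw [hc]; field_simp
    set σ := Real.sqrt (1 - β₂) with hσ
    have hσσ : σ ^ 2 = 1 - β₂ := Real.sq_sqrt h2s.le
    have hb1 : Real.sqrt (1 - β₂ ^ (t + 1)) ≤ 1 := by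
      rw [Real.sqrt_le_one]; linarith [pow_nonneg h2.le (t + 1)]
    have e1 : Real.sqrt (u (t + 1)) =
        Real.sqrt ((r * Real.sqrt (u t)) ^ 2 + (σ * |w t + h t|) ^ 2) := by
      rw [H.u_succ, mul_pow, mul_pow, Real.sq_sqrt hu, sq_abs, hrr, hσσ]
    have e2 : Real.sqrt (1 - β₂ ^ (t + 1)) * |w t| =
        Real.sqrt ((r * (Real.sqrt (1 - β₂ ^ t) * |w t|)) ^ 2 + (σ * |w t|) ^ 2) := by
      rw [mul_pow, mul_pow, mul_pow, Real.sq_sqrt hp, hrr, hσσ,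
        show β₂ * ((1 - β₂ ^ t) * |w t| ^ 2) + (1 - β₂) * |w t| ^ 2 =
          (1 - β₂ ^ (t + 1)) * |w t| ^ 2 by ring, Real.sqrt_mul hp', Real.sqrt_sq (abs_nonneg _)]
    have e3 : |Real.sqrt (u (t + 1)) - Real.sqrt (1 - β₂ ^ (t + 1)) * (|w t|)| ≤
        (1 + r * c) * R := by
      rw [e1, e2]
      refine (abs_sqrt_sub_sqrt_le _ _ _ _).trans ?_
      rw [Real.sqrt_le_left (by positivity), ← mul_sub, ← mul_sub, mul_pow, mul_pow, hrr, hσσ]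
      have f1 : (Real.sqrt (u t) - Real.sqrt (1 - β₂ ^ t) * |w t|) ^ 2 ≤ ((1 + c) * R) ^ 2 := by
        rw [← sq_abs]; gcongr
      have f2 : (|w t + h t| - |w t|) ^ 2 ≤ R ^ 2 := by
        rw [← sq_abs]
        gcongr
        refine (abs_abs_sub_abs_le _ _).trans ?_
        simpa using hht
      calc _ ≤ β₂ * ((1 + c) * R) ^ 2 + (1 - β₂) * R ^ 2 := by gcongr
        _ = (1 + 2 * (r * r * c) + r ^ 2 * c ^ 2) * R ^ 2 := by rw [← hrr]; ring
        _ ≤ (1 + 2 * (1 * r * c) + r ^ 2 * c ^ 2) * R ^ 2 := by gcongr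
        _ = _ := by ring
    have e4 : |Real.sqrt (1 - β₂ ^ (t + 1)) * |w t| - Real.sqrt (1 - β₂ ^ (t + 1)) *
        (|w (t + 1)|)| ≤ stepBound β₁ β₂ * R := by
      rw [← mul_sub, abs_mul, abs_of_nonneg (Real.sqrt_nonneg _)]
      exact (mul_le_mul hb1 ((abs_abs_sub_abs_le _ _).trans hw) (abs_nonneg _) zero_le_one).trans_eq
        (one_mul _)
    calc _ ≤ _ := abs_sub_le _ (Real.sqrt (1 - β₂ ^ (t + 1)) * |w t|) _
      _ ≤ (1 + r * c) * R + stepBound β₁ β₂ * R := add_le_add e3 e4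
      _ = _ := by rw [← hcC]; ring
end

/-! ### One coordinate of Adam: comparison with soft thresholding -/

theorem ScalarAdam.neg {β₁ β₂ η ε : ℝ} {w m u h : ℕ → ℝ} (H : ScalarAdam β₁ β₂ η ε w m u h) :
    ScalarAdam β₁ β₂ η ε (fun t => -w t) (fun t => -m t) u (fun t => -h t) where
  m_zero := by simp [H.m_zero]
  u_zero := H.u_zero
  m_succ t := by rw [H.m_succ]; ring
  u_succ t := by rw [H.u_succ]; ring
  w_succ t := by rw [H.w_succ]; ring

theorem ScalarAdam.w_one {β₁ β₂ η ε : ℝ} {w m u h : ℕ → ℝ} (H : ScalarAdam β₁ β₂ η ε w m u h) :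
    w 1 = w 0 := by
  have := H.w_succ 0
  simpa [H.m_zero] using this

theorem biasRatio_zero (β₁ β₂ : ℝ) : biasRatio β₁ β₂ 0 = 0 := by simp [biasRatio]

/-- As long as the weight dominates the scale `R` of the perturbation, of the learning rate and of
the stability constant, Adam makes the step that it makes for constant gradients, with a relative
error of order `R / w t`. In particular it moves towards `0` without overshooting. -/
theorem exists_step_estimate {β₁ β₂ : ℝ} (h1 : 0 ≤ β₁) (h1' : β₁ < 1) (h2' : β₂ < 1)
    (hβ : β₁ ^ 2 < β₂) :
    ∃ C K : ℝ, 1 ≤ C ∧ 1 ≤ K ∧ ∀ {η ε R : ℝ} {w m u h : ℕ → ℝ} {N : ℕ},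
      ScalarAdam β₁ β₂ η ε w m u h → 0 < η → 0 < ε → η ≤ R → ε ≤ R → (∀ τ < N, |h τ| ≤ R) →
      ∀ t, 1 ≤ t → t ≤ N → K * R ≤ w t →
        |m t / (Real.sqrt (u t) + ε) - biasRatio β₁ β₂ t| ≤ C * R / w t ∧
        (1 - β₁) / 2 ≤ m t / (Real.sqrt (u t) + ε) ∧
        η * (m t / (Real.sqrt (u t) + ε)) ≤ w t := by
  have h2 : 0 < β₂ := lt_of_le_of_lt (sq_nonneg _) hβ
  have h1s : 0 < 1 - β₁ := by linarith
  set b := Real.sqrt (1 - β₂) with hb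
  have hb0 : 0 < b := Real.sqrt_pos.2 (by linarith)
  set E₁ := 1 + stepBound β₁ β₂ / (1 - β₁) with hE₁
  set E₂ := 1 + stepBound β₁ β₂ / (1 - Real.sqrt β₂) with hE₂
  have hsb : 0 ≤ stepBound β₁ β₂ := Real.sqrt_nonneg _
  have hE₁1 : 1 ≤ E₁ := le_add_of_nonneg_right (by positivity)
  have hE₂1 : 1 ≤ E₂ := by
    have : Real.sqrt β₂ < 1 := by rw [Real.sqrt_lt' one_pos]; simpa using h2'
    exact le_add_of_nonneg_right (div_nonneg hsb (by linarith))
  -- `C` is what comes out of the relative error below; `K` makes the denominator at least half of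
  -- its main term, the relative error at most one half, and a full step shorter than `K * R`
  set C := max 1 ((E₁ + 1 / b * (E₂ + 1)) * (2 / b)) with hC
  have hC1 : 1 ≤ C := le_max_left _ _
  set K := max 1 (max (2 * E₂ / b) (max (2 * C / (1 - β₁)) (stepBound β₁ β₂))) with hK
  have hK1 : 1 ≤ K := le_max_left _ _
  have hK2 : 2 * E₂ / b ≤ K := (le_max_left _ _).trans (le_max_right _ _)
  have hK3 : 2 * C / (1 - β₁) ≤ K :=
    (le_max_left _ _).trans ((le_max_right _ _).trans (le_max_right _ _))
  have hK4 : stepBound β₁ β₂ ≤ K :=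
    (le_max_right _ _).trans ((le_max_right _ _).trans (le_max_right _ _))
  refine ⟨C, K, hC1, hK1, ?_⟩
  intro η ε R w m u h N H hη hε hηR hεR hh t ht1 htN hw
  have hR : 0 < R := hη.trans_le hηR
  have hwR : R ≤ w t := le_trans (le_mul_of_one_le_left hR.le hK1) hw
  have hw0 : 0 < w t := hR.trans_le hwR
  have hm := H.abs_m_sub_le h1 h1' h2 h2' hβ hε hη hηR hh t htN
  have hu := H.abs_sqrt_u_sub_le h2 h2' hβ hε hη hηR hh t htN
  rw [← hE₁] at hm
  rw [← hE₂, abs_of_pos hw0] at hu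
  set bt := Real.sqrt (1 - β₂ ^ t) with hbt
  set a₁ := 1 - β₁ ^ t with hat
  have hpow1 : β₁ ^ t ≤ β₁ := by simpa using pow_le_pow_of_le_one h1 h1'.le ht1
  have hpow2 : β₂ ^ t ≤ β₂ := by simpa using pow_le_pow_of_le_one h2.le h2'.le ht1
  have hbtb : b ≤ bt := Real.sqrt_le_sqrt (by linarith)
  have hbt0 : 0 < bt := hb0.trans_le hbtb
  have hbt1 : bt ≤ 1 := by
    rw [hbt, Real.sqrt_le_one]; linarith [pow_nonneg h2.le t]
  have hat1 : a₁ ≤ 1 := by rw [hat]; linarith [pow_nonneg h1 t]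
  have hat0 : 1 - β₁ ≤ a₁ := by rw [hat]; linarith
  set r := biasRatio β₁ β₂ t with hr
  have hrdef : r * bt = a₁ := by
    rw [hr, biasRatio, div_mul_cancel₀ _ hbt0.ne']
  have hrmin : 1 - β₁ ≤ r := by nlinarith
  have hrmax : r ≤ 1 / b := by
    rw [le_div_iff₀ hb0]; nlinarith
  set D := Real.sqrt (u t) + ε with hD
  have hDlow : b / 2 * w t ≤ D := by
    have h3 : 2 * E₂ / b * R ≤ w t := (mul_le_mul_of_nonneg_right hK2 hR.le).trans hw
    have h4 : E₂ * R ≤ b / 2 * w t := by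
      calc E₂ * R = b / 2 * (2 * E₂ / b * R) := by field_simp
        _ ≤ _ := by gcongr
    have h5 : b * w t ≤ bt * w t := by gcongr
    linarith [(abs_le.1 hu).1]
  have hD0 : 0 < D := lt_of_lt_of_le (by positivity) hDlow
  have hnum : |m t - r * D| ≤ (E₁ + 1 / b * (E₂ + 1)) * R := by
    have e : m t - r * D = (m t - a₁ * w t) - r * ((Real.sqrt (u t) - bt * w t) + ε) := by
      rw [← hrdef, hD]; ring
    rw [e]
    have hr0 : 0 ≤ r := h1s.le.trans hrmin
    calc _ ≤ |m t - a₁ * w t| + |r * ((Real.sqrt (u t) - bt * w t) + ε)| := abs_sub _ _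
      _ ≤ E₁ * R + 1 / b * (E₂ * R + R) := by
        rw [abs_mul, abs_of_nonneg hr0]
        gcongr
        refine (abs_add_le _ _).trans (add_le_add hu ?_)
        rwa [abs_of_pos hε]
      _ = _ := by ring
  have hmain : |m t / D - r| ≤ C * R / w t := by
    have e : m t / D - r = (m t - r * D) / D := by field_simp
    rw [e, abs_div, abs_of_pos hD0]
    calc _ ≤ (E₁ + 1 / b * (E₂ + 1)) * R / (b / 2 * w t) := by gcongr
      _ = (E₁ + 1 / b * (E₂ + 1)) * (2 / b) * R / w t := by field_simp
      _ ≤ C * R / w t := by gcongr; exact le_max_right _ _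
  refine ⟨hmain, ?_, ?_⟩
  · have : C * R / w t ≤ (1 - β₁) / 2 := by
      rw [div_le_iff₀ hw0]
      have h3 : 2 * C / (1 - β₁) * R ≤ w t := (mul_le_mul_of_nonneg_right hK3 hR.le).trans hw
      calc C * R = (1 - β₁) / 2 * (2 * C / (1 - β₁) * R) := by field_simp
        _ ≤ _ := by gcongr
    linarith [(abs_le.1 hmain).1]
  · have h3 := (abs_le.1 (H.abs_step_le h2 h2' hβ hε t)).2
    calc η * (m t / D) ≤ η * stepBound β₁ β₂ := by gcongr
      _ ≤ R * K := by gcongr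
      _ ≤ w t := by rw [mul_comm]; exact hw

/-- The case of `exists_tracking` of a nonnegative initial weight. While the weight dominates `R`,
the accumulated error of the comparison with soft thresholding is bounded by a multiple of
`R * log (w 0 / w t)`: the relative step errors `R / w t` sum up to a logarithm. Once the weight has
come down to the scale of `R`, it stays there. -/
theorem exists_tracking_of_nonneg {β₁ β₂ : ℝ} (h1 : 0 ≤ β₁) (h1' : β₁ < 1) (h2' : β₂ < 1)
    (hβ : β₁ ^ 2 < β₂) :
    ∃ C : ℝ, 0 ≤ C ∧ ∀ {η ε R : ℝ} {w m u h : ℕ → ℝ} {N : ℕ},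
      ScalarAdam β₁ β₂ η ε w m u h → 0 < η → 0 < ε → η ≤ R → ε ≤ R → (∀ τ < N, |h τ| ≤ R) →
      0 ≤ w 0 → ∀ t ≤ N, |w t| ≤ w 0 + C * R ∧
        ∀ L, 0 ≤ L → w 0 ≤ Real.exp L * R →
          |w t - softThreshold (travel β₁ β₂ η t) (w 0)| ≤ C * R * (1 + L) := by
  obtain ⟨C, K, hC1, hK1, hstep⟩ := exists_step_estimate h1 h1' h2' hβ
  have h2 : 0 < β₂ := lt_of_le_of_lt (sq_nonneg _) hβ
  have h1s : 0 < 1 - β₁ := by linarith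
  set sb := stepBound β₁ β₂ with hsbdef
  have hsb : 0 ≤ sb := Real.sqrt_nonneg _
  set C' := 2 * C / (1 - β₁) with hC'
  have hC'0 : 0 ≤ C' := by positivity
  refine ⟨2 * (K + sb) + C', by positivity, ?_⟩
  intro η ε R w m u h N H hη hε hηR hεR hh hw0
  have hR : 0 < R := hη.trans_le hηR
  set c := travel β₁ β₂ η with hc
  have hc0 : ∀ t, 0 ≤ c t := fun t => travel_nonneg h1 h1' hη t
  have hcs : ∀ t, c t ≤ c (t + 1) := fun t => by
    rw [hc, travel_succ]
    exact le_add_of_nonneg_right (mul_nonneg hη.le (biasRatio_nonneg h1 h1' _))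
  have hRK : R ≤ K * R := le_mul_of_one_le_left hR.le hK1
  have hmove : ∀ t, |w t - w (t + 1)| ≤ sb * R := fun t =>
    H.abs_w_succ_sub_le h2 h2' hβ hε hη hηR t
  have hlog : ∀ {x L : ℝ}, R ≤ x → 0 ≤ L → 0 < w 0 → w 0 ≤ Real.exp L * R →
      Real.log (w 0) - Real.log x ≤ L := by
    intro x L hx _ hw hL
    have hx0 : 0 < x := hR.trans_le hx
    rw [sub_le_iff_le_add, Real.log_le_iff_le_exp hw, Real.exp_add, Real.exp_log hx0]
    exact hL.trans (by gcongr)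
  -- either the weight still dominates `R` and follows `w 0 - c t`, or it has come down to `R`
  have inv : ∀ t ≤ N,
      (K * R ≤ w t ∧ w t ≤ w 0 ∧
        |w t - (w 0 - c t)| ≤ C' * R * (Real.log (w 0) - Real.log (w t))) ∨
      (|w t| ≤ (K + sb) * R ∧ ∀ L, 0 ≤ L → w 0 ≤ Real.exp L * R →
        w 0 - c t ≤ (K + sb) * R + C' * R * L) := by
    intro t
    induction t with
    | zero =>
      intro _
      have hc00 : c 0 = 0 := by simp [hc, travel]
      rcases le_or_gt (K * R) (w 0) with hk | hk
      · left
        simp [hk, hc00]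
      · right
        have : 0 ≤ sb * R := by positivity
        refine ⟨by rw [abs_of_nonneg hw0]; linarith, fun L hL _ => ?_⟩
        have : 0 ≤ C' * R * L := by positivity
        rw [hc00]; linarith
    | succ t ih =>
      intro htN
      have ih := ih (by omega)
      rcases Nat.eq_zero_or_pos t with rfl | ht1
      · have hc1 : c (0 + 1) = c 0 := by
          rw [hc, travel_succ, biasRatio_zero, mul_zero, add_zero]
        have hw1 : w (0 + 1) = w 0 := H.w_one
        rw [hc1, hw1]
        exact ih
      · rcases ih with ⟨hk, hle, herr⟩ | ⟨hsmall, hB⟩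
        · obtain ⟨s1, s2, s3⟩ := hstep H hη hε hηR hεR hh t ht1 (by omega) hk
          set st := m t / (Real.sqrt (u t) + ε) with hst
          have hws : w (t + 1) = w t - η * st := H.w_succ t
          have hst0 : 0 ≤ st := le_trans (by linarith) s2
          have hwt : 0 < w t := hR.trans_le (hRK.trans hk)
          have hw00 : 0 < w 0 := hwt.trans_le hle
          have hdec : w (t + 1) ≤ w t := by
            rw [hws]; have : 0 ≤ η * st := by positivity
            linarith
          rcases le_or_gt (K * R) (w (t + 1)) with hk' | hk'
          · left
            refine ⟨hk', hdec.trans hle, ?_⟩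
            have hw' : 0 < w (t + 1) := hR.trans_le (hRK.trans hk')
            -- `1 - w (t+1) / w t ≤ log (w t / w (t+1))` makes the step errors telescope
            have hl : (w t - w (t + 1)) / w t ≤ Real.log (w t) - Real.log (w (t + 1)) := by
              have := Real.one_sub_inv_le_log_of_pos (div_pos hwt hw')
              rw [Real.log_div hwt.ne' hw'.ne', inv_div] at this
              calc _ = 1 - w (t + 1) / w t := by field_simp
                _ ≤ _ := this
            have hη' : η * (C * R / w t) ≤
                C' * R * (Real.log (w t) - Real.log (w (t + 1))) := by
              calc η * (C * R / w t) = C' * R * (η * ((1 - β₁) / 2) / w t) := by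
                    rw [hC']; field_simp
                _ ≤ C' * R * ((w t - w (t + 1)) / w t) := by
                    rw [hws, sub_sub_cancel]; gcongr
                _ ≤ _ := by gcongr
            have e : w (t + 1) - (w 0 - c (t + 1)) =
                (w t - (w 0 - c t)) - η * (st - biasRatio β₁ β₂ t) := by
              rw [hws, hc, travel_succ]; ring
            rw [e]
            calc _ ≤ |w t - (w 0 - c t)| + |η * (st - biasRatio β₁ β₂ t)| := abs_sub _ _
              _ ≤ C' * R * (Real.log (w 0) - Real.log (w t)) + η * (C * R / w t) := by
                rw [abs_mul, abs_of_pos hη]; gcongr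
              _ ≤ _ := by linarith
          · right
            have h0 : 0 ≤ w (t + 1) := by rw [hws]; linarith
            have hm := (abs_le.1 (hmove t)).2
            have hp : 0 ≤ sb * R := by positivity
            refine ⟨by rw [abs_of_nonneg h0]; linarith, fun L hL hLw => ?_⟩
            have hlg := hlog (hRK.trans hk) hL hw00 hLw
            have h5 : C' * R * (Real.log (w 0) - Real.log (w t)) ≤ C' * R * L := by gcongr
            have := hcs t
            have := (abs_le.1 herr).1
            linarith
        · right
          refine ⟨?_, fun L hL hLw => ?_⟩
          · have hm := abs_le.1 (hmove t)
            rcases le_or_gt (K * R) (w t) with hk | hk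
            · obtain ⟨s1, s2, s3⟩ := hstep H hη hε hηR hεR hh t ht1 (by omega) hk
              have hws := H.w_succ t
              have : 0 ≤ η * (m t / (Real.sqrt (u t) + ε)) := mul_nonneg hη.le (by linarith)
              have := (abs_le.1 hsmall).2
              rw [abs_le]
              constructor <;> nlinarith
            · rcases le_or_gt (K * R) (-w t) with hk' | hk'
              · obtain ⟨s1, s2, s3⟩ := hstep H.neg hη hε hηR hεR
                  (by simpa only [abs_neg] using hh) t ht1 (by omega) hk'
                have hws := H.w_succ t
                rw [neg_div] at s2 s3
                have : η * (m t / (Real.sqrt (u t) + ε)) ≤ 0 :=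
                  mul_nonpos_of_nonneg_of_nonpos hη.le (by linarith)
                have := (abs_le.1 hsmall).1
                rw [abs_le]
                constructor <;> nlinarith
              · rw [abs_le]
                constructor <;> linarith
          · have := hcs t
            have := hB L hL hLw
            linarith
  intro t ht
  have hsoft := softThreshold_of_nonneg (hc0 t) hw0
  rcases inv t ht with ⟨hk, hle, herr⟩ | ⟨hsmall, hB⟩
  · have hwt : 0 < w t := hR.trans_le (hRK.trans hk)
    refine ⟨?_, fun L hL hLw => ?_⟩
    · rw [abs_of_pos hwt]
      have : 0 ≤ (2 * (K + sb) + C') * R := by positivity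
      linarith
    · rw [hsoft]
      have hlg := hlog (hRK.trans hk) hL (hwt.trans_le hle) hLw
      calc |w t - max (w 0 - c t) 0| = |max (w t) 0 - max (w 0 - c t) 0| := by
            rw [max_eq_left hwt.le]
        _ ≤ |w t - (w 0 - c t)| := abs_max_sub_max_le_abs _ _ _
        _ ≤ C' * R * L := herr.trans (by gcongr)
        _ ≤ (2 * (K + sb) + C') * R * (1 + L) := by
            have : 0 ≤ 2 * (K + sb) * R * (1 + L) + C' * R := by positivity
            linarith
  · refine ⟨?_, fun L hL hLw => ?_⟩
    · have : 0 ≤ (K + sb + C') * R := by positivity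
      linarith
    · rw [hsoft]
      have h3 := hB L hL hLw
      have h4 : 0 ≤ (K + sb) * R := by positivity
      have h5 : 0 ≤ C' * R * L := by positivity
      have h6 : max (w 0 - c t) 0 ≤ (K + sb) * R + C' * R * L := max_le h3 (by linarith)
      have h7 : 0 ≤ 2 * (K + sb) * R * L + C' * R := by positivity
      calc _ ≤ |w t| + |max (w 0 - c t) 0| := abs_sub _ _
        _ ≤ (K + sb) * R + ((K + sb) * R + C' * R * L) := by
            rw [abs_of_nonneg (le_max_right (w 0 - c t) 0)]; linarith
        _ ≤ _ := by linarith

/-- One coordinate of Adam under weight decay follows, up to a multiple of the scale `R` of the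
perturbation and a logarithm, the soft thresholding of its initial value at a level that depends on
time only. -/
theorem exists_tracking {β₁ β₂ : ℝ} (h1 : 0 ≤ β₁) (h1' : β₁ < 1) (h2' : β₂ < 1)
    (hβ : β₁ ^ 2 < β₂) :
    ∃ C : ℝ, 0 ≤ C ∧ ∀ {η ε R : ℝ} {w m u h : ℕ → ℝ} {N : ℕ},
      ScalarAdam β₁ β₂ η ε w m u h → 0 < η → 0 < ε → η ≤ R → ε ≤ R → (∀ τ < N, |h τ| ≤ R) →
      ∀ t ≤ N, |w t| ≤ |w 0| + C * R ∧
        ∀ L, 0 ≤ L → |w 0| ≤ Real.exp L * R →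
          |w t - softThreshold (travel β₁ β₂ η t) (w 0)| ≤ C * R * (1 + L) := by
  obtain ⟨C, hC0, hC⟩ := exists_tracking_of_nonneg h1 h1' h2' hβ
  refine ⟨C, hC0, ?_⟩
  intro η ε R w m u h N H hη hε hηR hεR hh t ht
  rcases le_total 0 (w 0) with hw | hw
  · rw [abs_of_nonneg hw]
    exact hC H hη hε hηR hεR hh hw t ht
  · rw [abs_of_nonpos hw]
    have := hC H.neg hη hε hηR hεR (by simpa only [abs_neg] using hh) (neg_nonneg.2 hw) t ht
    simpa only [abs_neg, softThreshold_neg, sub_neg_eq_add, neg_add_eq_sub,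
      abs_sub_comm _ (w t)] using this

/-! ### The gradient of the loss -/

theorem hasDerivAt_activation {q : ℝ} (hq : 1 < q) (x : ℝ) :
    HasDerivAt (activation q) (q * max x 0 ^ (q - 1)) x := by
  rcases lt_trichotomy x 0 with hx | rfl | hx
  · rw [max_eq_right hx.le, Real.zero_rpow (by linarith), mul_zero]
    refine (hasDerivAt_const x (0 : ℝ)).congr_of_eventuallyEq ?_
    filter_upwards [gt_mem_nhds hx] with y hy
    rw [activation, max_eq_right hy.le, Real.zero_rpow (by linarith)]
  · have h := hasDerivAt_abs_rpow 0 hq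
    rw [max_self, Real.zero_rpow (by linarith), mul_zero]
    rw [mul_zero, hasDerivAt_iff_isLittleO_nhds_zero] at h
    rw [hasDerivAt_iff_isLittleO_nhds_zero]
    refine (IsBigO.of_norm_le fun y => ?_).trans_isLittleO h
    have hq0 : q ≠ 0 := by linarith
    simp only [activation, zero_add, max_self, abs_zero, Real.zero_rpow hq0, smul_zero, sub_zero,
      Real.norm_eq_abs]
    rw [abs_of_nonneg (by positivity)]
    gcongr
    exact max_le (le_abs_self _) (abs_nonneg _)
  · rw [max_eq_left hx.le]
    refine (Real.hasDerivAt_rpow_const (Or.inl hx.ne')).congr_of_eventuallyEq ?_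
    filter_upwards [lt_mem_nhds hx] with y hy
    rw [activation, max_eq_left hy.le]

section
variable {m d : ℕ}

theorem setEntry_dotProduct (W : Weights m d) (j : ℤˣ) (r : Fin m) (k : Fin d) (z : ℝ)
    (x : Fin d → ℝ) (j' : ℤˣ) (r' : Fin m) :
    W.setEntry j r k z j' r' ⬝ᵥ x =
      W j' r' ⬝ᵥ x + if j' = j ∧ r' = r then (z - W j r k) * x k else 0 := by
  unfold Weights.setEntry
  by_cases hj : j' = j
  · subst hj
    rw [Function.update_self]
    by_cases hr : r' = r
    · subst hr
      rw [Function.update_self, if_pos ⟨rfl, rfl⟩]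
      have : Function.update (W j' r') k z = W j' r' + Pi.single k (z - W j' r' k) := by
        ext l
        by_cases hl : l = k
        · subst hl; simp
        · simp [hl]
      rw [this, add_dotProduct, single_dotProduct]
    · rw [Function.update_of_ne hr, if_neg (fun h => hr h.2), add_zero]
  · rw [Function.update_of_ne hj, if_neg (fun h => hj h.1), add_zero]

/-- The derivative of the output `F_j'` in the entry `w_{j,r}[k]`. -/
theorem hasDerivAt_netOutput {q : ℝ} (hq : 1 < q) (W : Weights m d) (x₁ x₂ : Fin d → ℝ)
    (j : ℤˣ) (r : Fin m) (k : Fin d) (j' : ℤˣ) :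
    HasDerivAt (fun z => netOutput q (W.setEntry j r k z) x₁ x₂ j')
      (if j' = j then q * max (W j r ⬝ᵥ x₁) 0 ^ (q - 1) * x₁ k +
        q * max (W j r ⬝ᵥ x₂) 0 ^ (q - 1) * x₂ k else 0) (W j r k) := by
  unfold netOutput
  have key : ∀ (x : Fin d → ℝ) (r' : Fin m), HasDerivAt
      (fun z => activation q (W.setEntry j r k z j' r' ⬝ᵥ x))
      (if j' = j ∧ r' = r then q * max (W j r ⬝ᵥ x) 0 ^ (q - 1) * x k else 0) (W j r k) := by
    intro x r'
    simp only [setEntry_dotProduct]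
    by_cases h : j' = j ∧ r' = r
    · obtain ⟨rfl, rfl⟩ := h
      simp only [and_self, if_true]
      have h1 : HasDerivAt (fun z => W j' r' ⬝ᵥ x + (z - W j' r' k) * x k) (x k) (W j' r' k) := by
        simpa using (((hasDerivAt_id (W j' r' k)).sub_const (W j' r' k)).mul_const (x k)).const_add
          (W j' r' ⬝ᵥ x)
      have h2 : HasDerivAt (activation q) (q * max (W j' r' ⬝ᵥ x) 0 ^ (q - 1))
          (W j' r' ⬝ᵥ x + (W j' r' k - W j' r' k) * x k) := by
        simpa using hasDerivAt_activation hq (W j' r' ⬝ᵥ x)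
      exact h2.comp (W j' r' k) h1
    · simp only [if_neg h]
      exact hasDerivAt_const _ _
  have := HasDerivAt.fun_sum (u := Finset.univ) fun r' (_ : r' ∈ Finset.univ) =>
    (key x₁ r').add (key x₂ r')
  refine this.congr_deriv ?_
  by_cases hj : j' = j <;> simp [hj, Finset.sum_add_distrib]

/-- The derivative of the loss is at most that of the output in absolute value, since the logistic
factor lies in `[-1, 1]`. -/
theorem abs_partialDeriv_sampleLoss_le {q : ℝ} (hq : 1 < q) (α : ℝ) (ω : Draw d) (W : Weights m d)
    (j : ℤˣ) (r : Fin m) (k : Fin d) :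
    |partialDeriv (sampleLoss q α ω) W j r k| ≤
      q * |W j r ⬝ᵥ ω.signal| ^ (q - 1) * |ω.signal k| +
      q * |W j r ⬝ᵥ ω.noise α| ^ (q - 1) * |ω.noise α k| := by
  set x₁ := ω.patch₁ α with hx₁
  set x₂ := ω.patch₂ α with hx₂
  set D := q * max (W j r ⬝ᵥ x₁) 0 ^ (q - 1) * x₁ k +
        q * max (W j r ⬝ᵥ x₂) 0 ^ (q - 1) * x₂ k with hD
  have hF := fun j' => hasDerivAt_netOutput hq W x₁ x₂ j r k j'
  rw [← hD] at hF
  set F : ℤˣ → ℝ → ℝ := fun j' z => netOutput q (W.setEntry j r k z) x₁ x₂ j' with hFdef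
  set z₀ := W j r k
  set Z := ∑ j' : ℤˣ, Real.exp (F j' z₀) with hZ
  have hZpos : ∀ z, 0 < ∑ j' : ℤˣ, Real.exp (F j' z) := fun z =>
    Finset.sum_pos (fun _ _ => Real.exp_pos _) Finset.univ_nonempty
  have hloss : (fun z => sampleLoss q α ω (W.setEntry j r k z)) =
      fun z => Real.log (∑ j' : ℤˣ, Real.exp (F j' z)) - F ω.label z := by
    ext z
    have : sampleLoss q α ω (W.setEntry j r k z) =
      -Real.log (Real.exp (F ω.label z) / ∑ j' : ℤˣ, Real.exp (F j' z)) := rfl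
    rw [this, Real.log_div (Real.exp_pos _).ne' (hZpos z).ne', Real.log_exp]
    ring
  have hsum : HasDerivAt (fun z => ∑ j' : ℤˣ, Real.exp (F j' z)) (Real.exp (F j z₀) * D) z₀ := by
    have := HasDerivAt.fun_sum (u := Finset.univ) fun j' (_ : j' ∈ Finset.univ) => (hF j').exp
    refine this.congr_deriv ?_
    simp only [mul_ite, mul_zero, Finset.sum_ite_eq', Finset.mem_univ, if_true]
    rfl
  have hder := (hsum.log (hZpos z₀).ne').sub (hF ω.label)
  have hval : partialDeriv (sampleLoss q α ω) W j r k =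
      (Real.exp (F j z₀) / Z - if ω.label = j then 1 else 0) * D := by
    unfold partialDeriv
    rw [hloss]
    refine (HasDerivAt.deriv hder).trans ?_
    split_ifs <;> ring
  have hp0 : 0 ≤ Real.exp (F j z₀) / Z := div_nonneg (Real.exp_pos _).le (hZpos z₀).le
  have hp1 : Real.exp (F j z₀) / Z ≤ 1 := by
    rw [div_le_one (hZpos z₀)]
    exact Finset.single_le_sum (f := fun j' => Real.exp (F j' z₀))
      (fun _ _ => (Real.exp_pos _).le) (Finset.mem_univ j)
  have hfac : |Real.exp (F j z₀) / Z - if ω.label = j then 1 else 0| ≤ 1 := by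
    rw [abs_le]; split_ifs <;> constructor <;> linarith
  have hterm : ∀ x : Fin d → ℝ, |q * max (W j r ⬝ᵥ x) 0 ^ (q - 1) * x k| ≤
      q * |W j r ⬝ᵥ x| ^ (q - 1) * |x k| := fun x => by
    rw [abs_mul, abs_of_nonneg (by positivity : 0 ≤ q * max (W j r ⬝ᵥ x) 0 ^ (q - 1))]
    gcongr
    exact max_le (le_abs_self _) (abs_nonneg _)
  have hDle : |D| ≤ q * |W j r ⬝ᵥ x₁| ^ (q - 1) * |x₁ k| + q * |W j r ⬝ᵥ x₂| ^ (q - 1) * |x₂ k| :=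
    (abs_add_le _ _).trans (add_le_add (hterm x₁) (hterm x₂))
  rw [hval, abs_mul]
  refine (mul_le_of_le_one_left (abs_nonneg _) hfac).trans (hDle.trans (le_of_eq ?_))
  rw [hx₁, hx₂, Draw.patch₁, Draw.patch₂]
  split_ifs
  · rfl
  · exact add_comm _ _
end

/-! ### Training on the good event -/

/-- The gradient of the batch loss in the entry `w_{j,r}[k]`, in units of the weight decay. -/
noncomputable def relGrad (q : ℝ) {n : ℕ} (p : Params) (S : Fin n → Draw p.d)
    (I : Finset (Fin n)) (W : Weights p.m p.d) (j : ℤˣ) (r : Fin p.m) (k : Fin p.d) : ℝ :=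
  1 / (p.B : ℝ) * (∑ i ∈ I, partialDeriv (sampleLoss q p.α (S i)) W j r k) / p.lam

theorem stochGrad_eq {q : ℝ} {n : ℕ} {p : Params} (hlam : 0 < p.lam) (S : Fin n → Draw p.d)
    (I : Finset (Fin n)) (W : Weights p.m p.d) (j : ℤˣ) (r : Fin p.m) (k : Fin p.d) :
    stochGrad q p S I W j r k = p.lam * (W j r k + relGrad q p S I W j r k) := by
  unfold stochGrad relGrad
  field_simp
  ring

/-- Adam is invariant under a common rescaling of gradients and stability constant; dividing by the
weight decay puts every coordinate into the normal form `ScalarAdam`. -/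
theorem scalarAdam_adam (q β₁ β₂ : ℝ) {n : ℕ} {p : Params} (hlam : 0 < p.lam)
    (S : Fin n → Draw p.d) (I : ℕ → Finset (Fin n)) (W₀ : Weights p.m p.d)
    (j : ℤˣ) (r : Fin p.m) (k : Fin p.d) :
    ScalarAdam β₁ β₂ p.η (p.ε / p.lam) (fun t => (adam q β₁ β₂ p S I W₀ t).w j r k)
      (fun t => (adam q β₁ β₂ p S I W₀ t).mom₁ j r k / p.lam)
      (fun t => (adam q β₁ β₂ p S I W₀ t).mom₂ j r k / p.lam ^ 2)
      (fun t => relGrad q p S (I t) (adam q β₁ β₂ p S I W₀ t).w j r k) where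
  m_zero := by simp [adam]
  u_zero := by simp [adam]
  m_succ t := by
    simp only [adam, stochGrad_eq hlam]
    field_simp
  u_succ t := by
    simp only [adam, stochGrad_eq hlam]
    field_simp
  w_succ t := by
    simp only [adam]
    rw [Real.sqrt_div' _ (sq_nonneg _), Real.sqrt_sq hlam.le, ← add_div,
      div_div_div_cancel_right₀ hlam.ne']

theorem abs_signVal (y : ℤˣ) : |signVal y| = 1 := by
  rcases Int.units_eq_one_or y with rfl | rfl <;> simp [signVal]

section
variable {d : ℕ}

theorem dotProduct_signal (w : Fin d → ℝ) (ω : Draw d) :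
    w ⬝ᵥ ω.signal = signVal ω.label * (w ⬝ᵥ feature d) := by
  simp only [dotProduct, Draw.signal, Finset.mul_sum]
  exact Finset.sum_congr rfl fun _ _ => by ring

theorem dotProduct_noise (α : ℝ) (w : Fin d → ℝ) (ω : Draw d) :
    w ⬝ᵥ ω.noise α = ∑ k, (if ω.2.2.1 k then w k else 0) * ω.2.2.2 k -
      α * signVal ω.label * (w ⬝ᵥ feature d) := by
  simp only [dotProduct, Draw.noise, Finset.mul_sum, ← Finset.sum_sub_distrib]
  exact Finset.sum_congr rfl fun k _ => by split_ifs <;> ring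

theorem abs_dotProduct_feature_le {w : Fin d → ℝ} {b : ℝ} (hb : 0 ≤ b)
    (h : ∀ k : Fin d, (k : ℕ) = 0 → |w k| ≤ b) : |w ⬝ᵥ feature d| ≤ b := by
  rcases d with _ | d
  · simpa [dotProduct] using hb
  · have : w ⬝ᵥ feature (d + 1) = w 0 := by
      simp only [dotProduct, feature, Fin.val_eq_zero_iff, mul_ite, mul_one, mul_zero]
      simp
    rw [this]
    exact h 0 rfl

theorem signal_of_ne_zero (ω : Draw d) {k : Fin d} (hk : (k : ℕ) ≠ 0) : ω.signal k = 0 := by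
  simp [Draw.signal, feature, hk]

theorem abs_signal_le (ω : Draw d) (k : Fin d) : |ω.signal k| ≤ 1 := by
  rw [Draw.signal, abs_mul, abs_signVal, one_mul, feature]
  split_ifs <;> simp

end

/-- The inequalities between the parameters at one sample size on which the argument rests. Here `l`
stands for `log n`, and `C` for the constant of the comparison with soft thresholding. -/
structure Bounds (q C l : ℝ) (p : Params) : Prop where
  σp_pos : 0 < p.σp
  σp_le : p.σp ≤ 1
  σ₀_pos : 0 < p.σ₀
  α_nonneg : 0 ≤ p.α
  α_le : p.α ≤ 1
  η_pos : 0 < p.η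
  lam_pos : 0 < p.lam
  ε_pos : 0 < p.ε
  B_pos : 1 ≤ p.B
  l_ge : 5 ≤ l
  C_nonneg : 0 ≤ C
  C_le : C ≤ l
  s_σp_le : (p.s : ℝ) * p.σp ^ 2 ≤ 1
  η_le : p.η ≤ p.σ₀ * p.σp
  ε_le : p.ε / p.lam ≤ p.σ₀ * p.σp
  exp_ge : l ≤ Real.exp (l ^ 2) * p.σp
  grad_le : 2 * q * (p.σ₀ * l ^ 5) ^ (q - 1) * l ≤ p.lam * p.σ₀

/-- The event on which training is stuck: typical sizes of all Gaussian entries, and of the inner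
products of the noise vectors with the soft-thresholded initial weights. -/
structure GoodEvent {n : ℕ} (p : Params) (N : ℕ) (c : ℕ → ℝ) (l : ℝ) (S : Fin n → Draw p.d)
    (W₀ : Weights p.m p.d) : Prop where
  weight : ∀ j r k, |W₀ j r k| ≤ p.σ₀ * l
  gauss : ∀ i k, |(S i).2.2.2 k| ≤ p.σp * l
  mask : ∀ i, (S i).2.2.1 ∈ noiseMasks p.d p.s
  inner : ∀ t ≤ N, ∀ j r i,
    |∑ k, (if (S i).2.2.1 k then softThreshold (c t) (W₀ j r k) else 0) * (S i).2.2.2 k| ≤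
      Real.sqrt p.s * p.σp * p.σ₀ * l ^ 2

section
variable {q C l : ℝ} {p : Params} {n N : ℕ} {c : ℕ → ℝ} {S : Fin n → Draw p.d}
  {W₀ : Weights p.m p.d}

theorem Bounds.sqrt_s_σp_le (hb : Bounds q C l p) : Real.sqrt p.s * p.σp ≤ 1 := by
  have h := hb.s_σp_le
  have h1 : (Real.sqrt p.s * p.σp) ^ 2 ≤ 1 := by
    rwa [mul_pow, Real.sq_sqrt (Nat.cast_nonneg _)]
  have := hb.σp_pos
  exact (sq_le_one_iff₀ (by positivity)).1 h1

theorem GoodEvent.abs_noise_le (hb : Bounds q C l p) (hG : GoodEvent p N c l S W₀) (i : Fin n)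
    {k : Fin p.d} (hk : (k : ℕ) ≠ 0) : |(S i).noise p.α k| ≤ p.σp * l := by
  have h1 := hb.σp_pos
  have h2 := hb.l_ge
  simp only [Draw.noise, feature, if_neg hk, mul_zero, sub_zero]
  split_ifs
  · exact hG.gauss i k
  · rw [abs_zero]; positivity

theorem GoodEvent.abs_noise_zero_le (hb : Bounds q C l p) (hG : GoodEvent p N c l S W₀)
    (i : Fin n) {k : Fin p.d} (hk : (k : ℕ) = 0) : |(S i).noise p.α k| ≤ 1 := by
  have h := (hG.mask i).1 k hk
  simp only [Draw.noise, feature, if_pos hk, mul_one, h]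
  simp only [Bool.false_eq_true, if_false, zero_sub, abs_neg, abs_mul, abs_signVal, mul_one]
  rw [abs_of_nonneg hb.α_nonneg]
  exact hb.α_le

/-- Inner products with the noise vectors are controlled for every weight vector that is
entrywise close to a soft thresholding of the initial one. The first term is the random one; the
drift contributes at most its size times the `ℓ¹`-norm of the noise vector. -/
theorem GoodEvent.abs_dotProduct_noise_le (hb : Bounds q C l p) (hG : GoodEvent p N c l S W₀)
    {w : Fin p.d → ℝ} {t : ℕ} (ht : t ≤ N) {j : ℤˣ} {r : Fin p.m}
    (h0 : |w ⬝ᵥ feature p.d| ≤ 2 * (p.σ₀ * l))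
    (h1 : ∀ k : Fin p.d, (k : ℕ) ≠ 0 →
      |w k - softThreshold (c t) (W₀ j r k)| ≤ C * (p.σ₀ * p.σp) * (1 + l ^ 2)) (i : Fin n) :
    |w ⬝ᵥ (S i).noise p.α| ≤
      3 * l ^ 4 * (Real.sqrt p.s * p.σp * p.σ₀) + p.α * (2 * (p.σ₀ * l)) := by
  have hσp := hb.σp_pos
  have hσ₀ := hb.σ₀_pos
  have hl := hb.l_ge
  have hC := hb.C_nonneg
  obtain ⟨hm0, hms⟩ := hG.mask i
  set b := (S i).2.2.1
  set z := (S i).2.2.2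
  set E := C * (p.σ₀ * p.σp) * (1 + l ^ 2) with hE
  have hdrift : |∑ k, (if b k then w k - softThreshold (c t) (W₀ j r k) else 0) * z k| ≤
      p.s * (E * (p.σp * l)) := by
    calc _ ≤ ∑ k, |(if b k then w k - softThreshold (c t) (W₀ j r k) else 0) * z k| :=
          Finset.abs_sum_le_sum_abs _ _
      _ ≤ ∑ k, if b k = true then E * (p.σp * l) else 0 := by
          refine Finset.sum_le_sum fun k _ => ?_
          split_ifs with hk
          · have hk0 : (k : ℕ) ≠ 0 := fun h => by simp [hm0 k h] at hk
            rw [abs_mul]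
            exact mul_le_mul (h1 k hk0) (hG.gauss i k) (abs_nonneg _) (by positivity)
          · simp
      _ = _ := by rw [← Finset.sum_filter, Finset.sum_const, hms, nsmul_eq_mul]
  have hsplit : ∑ k, (if b k then w k else 0) * z k =
      ∑ k, (if b k then softThreshold (c t) (W₀ j r k) else 0) * z k +
        ∑ k, (if b k then w k - softThreshold (c t) (W₀ j r k) else 0) * z k := by
    rw [← Finset.sum_add_distrib]
    exact Finset.sum_congr rfl fun k _ => by split_ifs <;> ring
  have hss : (p.s : ℝ) = Real.sqrt p.s * Real.sqrt p.s :=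
    (Real.mul_self_sqrt (Nat.cast_nonneg _)).symm
  set x := Real.sqrt p.s with hx
  have hx0 : 0 ≤ x := Real.sqrt_nonneg _
  have hdrift' : p.s * (E * (p.σp * l)) ≤ 2 * l ^ 4 * (x * p.σp * p.σ₀) := by
    calc _ = (x * p.σp) * (C * (1 + l ^ 2) * l) * (x * p.σp * p.σ₀) := by rw [hss, hE]; ring
      _ ≤ 1 * (l * (l ^ 2 + l ^ 2) * l) * (x * p.σp * p.σ₀) := by
          gcongr
          · exact hb.sqrt_s_σp_le
          · exact hb.C_le
          · nlinarith
      _ = _ := by ring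
  have hrand : x * p.σp * p.σ₀ * l ^ 2 ≤ l ^ 4 * (x * p.σp * p.σ₀) := by
    rw [mul_comm]
    gcongr
    · linarith
    · norm_num
  rw [dotProduct_noise, hsplit]
  have hfeat : |p.α * signVal (S i).label * (w ⬝ᵥ feature p.d)| ≤ p.α * (2 * (p.σ₀ * l)) := by
    rw [abs_mul, abs_mul, abs_signVal, mul_one, abs_of_nonneg hb.α_nonneg]
    exact mul_le_mul_of_nonneg_left h0 hb.α_nonneg
  refine (abs_sub _ _).trans (add_le_add ((abs_add_le _ _).trans ?_) hfeat)
  have := hG.inner t ht j r i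
  linarith

/-- The pull of the data is weaker than that of the weight decay on a weight of size
`σ₀` in the feature coordinate and of size `σ₀ σp` in the others. -/
theorem GoodEvent.abs_relGrad_le (hq : 1 < q) (hb : Bounds q C l p) (hG : GoodEvent p N c l S W₀)
    {I : Finset (Fin n)} (hI : I.card = p.B) {W : Weights p.m p.d} {j : ℤˣ} {r : Fin p.m}
    (h0 : |W j r ⬝ᵥ feature p.d| ≤ p.σ₀ * l ^ 5)
    (h1 : ∀ i, |W j r ⬝ᵥ (S i).noise p.α| ≤ p.σ₀ * l ^ 5) (k : Fin p.d) :
    |relGrad q p S I W j r k| ≤ if (k : ℕ) = 0 then p.σ₀ else p.σ₀ * p.σp := by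
  have hσp := hb.σp_pos
  have hσ₀ := hb.σ₀_pos
  have hl := hb.l_ge
  have hlam := hb.lam_pos
  have hq1 : 0 ≤ q - 1 := by linarith
  have hgrad := hb.grad_le
  set G := (p.σ₀ * l ^ 5) ^ (q - 1) with hGdef
  have hG0 : 0 ≤ G := by positivity
  set ρ := if (k : ℕ) = 0 then p.σ₀ else p.σ₀ * p.σp with hρ
  have hpd : ∀ i, |partialDeriv (sampleLoss q p.α (S i)) W j r k| ≤ p.lam * ρ := by
    intro i
    refine (abs_partialDeriv_sampleLoss_le hq _ _ _ _ _ _).trans ?_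
    have hs : |W j r ⬝ᵥ (S i).signal| ^ (q - 1) ≤ G := by
      refine Real.rpow_le_rpow (abs_nonneg _) ?_ hq1
      rwa [dotProduct_signal, abs_mul, abs_signVal, one_mul]
    have hn : |W j r ⬝ᵥ (S i).noise p.α| ^ (q - 1) ≤ G :=
      Real.rpow_le_rpow (abs_nonneg _) (h1 i) hq1
    by_cases hk : (k : ℕ) = 0
    · rw [hρ, if_pos hk]
      calc _ ≤ q * G * 1 + q * G * 1 := by
            gcongr
            · exact abs_signal_le _ _
            · exact hG.abs_noise_zero_le hb i hk
        _ = 2 * q * G * 1 := by ring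
        _ ≤ 2 * q * G * l := by gcongr; linarith
        _ ≤ _ := hgrad
    · rw [hρ, if_neg hk, signal_of_ne_zero _ hk, abs_zero, mul_zero, zero_add]
      calc _ ≤ q * G * (p.σp * l) := by
            gcongr
            exact hG.abs_noise_le hb i hk
        _ = (1 * q * G * l) * p.σp := by ring
        _ ≤ (2 * q * G * l) * p.σp := by gcongr; norm_num
        _ ≤ (p.lam * p.σ₀) * p.σp := by gcongr
        _ = _ := by ring
  have hB : (0 : ℝ) < p.B := by exact_mod_cast hb.B_pos
  unfold relGrad
  rw [abs_div, abs_mul, abs_of_pos hlam, abs_of_pos (by positivity : 0 < 1 / (p.B : ℝ)),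
    div_le_iff₀ hlam]
  have hsum : |∑ i ∈ I, partialDeriv (sampleLoss q p.α (S i)) W j r k| ≤ p.B * (p.lam * ρ) := by
    refine (Finset.abs_sum_le_sum_abs _ _).trans ((Finset.sum_le_card_nsmul _ _ _
      fun i _ => hpd i).trans (le_of_eq ?_))
    rw [hI, nsmul_eq_mul]
  calc _ ≤ 1 / (p.B : ℝ) * (p.B * (p.lam * ρ)) := by gcongr
    _ = _ := by field_simp

end

/-- On the good event the weights never leave the scale of the initialization. The bounds on the
weights and on the data gradient support each other, by induction over the iterations. -/
theorem exists_stuck {β₁ β₂ : ℝ} (h1 : 0 ≤ β₁) (h1' : β₁ < 1) (h2' : β₂ < 1)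
    (hβ : β₁ ^ 2 < β₂) :
    ∃ C : ℝ, 0 ≤ C ∧ ∀ {q l : ℝ} {p : Params} {n N : ℕ} {S : Fin n → Draw p.d}
      {W₀ : Weights p.m p.d}, 1 < q → Bounds q C l p →
      GoodEvent p N (travel β₁ β₂ p.η) l S W₀ → ∀ I : ℕ → Finset (Fin n),
      (∀ t, (I t).card = p.B) → ∀ t ≤ N, ∀ (j : ℤˣ) (r : Fin p.m),
        |(adam q β₁ β₂ p S I W₀ t).w j r ⬝ᵥ feature p.d| ≤ 2 * (p.σ₀ * l) ∧
        ∀ i, |(adam q β₁ β₂ p S I W₀ t).w j r ⬝ᵥ (S i).noise p.α| ≤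
          3 * l ^ 4 * (Real.sqrt p.s * p.σp * p.σ₀) + p.α * (2 * (p.σ₀ * l)) := by
  obtain ⟨C, hC0, htrack⟩ := exists_tracking h1 h1' h2' hβ
  refine ⟨C, hC0, ?_⟩
  intro q l p n N S W₀ hq hb hG I hI
  have hσp := hb.σp_pos
  have hσ₀ := hb.σ₀_pos
  have hl := hb.l_ge
  have hρR : p.σ₀ * p.σp ≤ p.σ₀ := mul_le_of_le_one_right hσ₀.le hb.σp_le
  have hε' : 0 < p.ε / p.lam := div_pos hb.ε_pos hb.lam_pos
  set A := fun t => (adam q β₁ β₂ p S I W₀ t).w with hA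
  -- a bound on the data gradient before time `t` bounds the inner products at time `t`
  have step : ∀ t ≤ N, ∀ (j : ℤˣ) (r : Fin p.m),
      (∀ τ < t, ∀ k, |relGrad q p S (I τ) (A τ) j r k| ≤
        if (k : ℕ) = 0 then p.σ₀ else p.σ₀ * p.σp) →
      |A t j r ⬝ᵥ feature p.d| ≤ 2 * (p.σ₀ * l) ∧
        ∀ i, |A t j r ⬝ᵥ (S i).noise p.α| ≤
          3 * l ^ 4 * (Real.sqrt p.s * p.σp * p.σ₀) + p.α * (2 * (p.σ₀ * l)) := by
    intro t ht j r hrel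
    have hfeat : |A t j r ⬝ᵥ feature p.d| ≤ 2 * (p.σ₀ * l) := by
      refine abs_dotProduct_feature_le (by positivity) fun k hk => ?_
      have h := (htrack (scalarAdam_adam q β₁ β₂ hb.lam_pos S I W₀ j r k) hb.η_pos hε'
        (hb.η_le.trans hρR) (hb.ε_le.trans hρR)
        (fun τ hτ => by simpa [hk] using hrel τ hτ k) t le_rfl).1
      have hw := hG.weight j r k
      have hCl : C * p.σ₀ ≤ l * p.σ₀ := mul_le_mul_of_nonneg_right hb.C_le hσ₀.le
      have h' : |A t j r k| ≤ |W₀ j r k| + C * p.σ₀ := h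
      linarith
    refine ⟨hfeat, hG.abs_dotProduct_noise_le hb ht (j := j) (r := r) hfeat fun k hk => ?_⟩
    refine (htrack (scalarAdam_adam q β₁ β₂ hb.lam_pos S I W₀ j r k) hb.η_pos hε'
        hb.η_le hb.ε_le (fun τ hτ => by simpa [hk] using hrel τ hτ k) t le_rfl).2
        (l ^ 2) (sq_nonneg l) ?_
    calc |W₀ j r k| ≤ p.σ₀ * l := hG.weight j r k
      _ ≤ p.σ₀ * (Real.exp (l ^ 2) * p.σp) := by gcongr; exact hb.exp_ge
      _ = _ := by ring
  have hrel : ∀ t, t ≤ N → ∀ (j : ℤˣ) (r : Fin p.m) (k : Fin p.d),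
      |relGrad q p S (I t) (A t) j r k| ≤ if (k : ℕ) = 0 then p.σ₀ else p.σ₀ * p.σp := by
    intro t
    induction t using Nat.strong_induction_on with
    | _ t ih =>
      intro ht j r k
      obtain ⟨hf, hn⟩ := step t ht j r fun τ hτ k => ih τ hτ (by omega) j r k
      have hl4 : 0 ≤ p.σ₀ * l ^ 4 := by positivity
      have hll : l ≤ l ^ 4 := le_self_pow₀ (by linarith) (by norm_num)
      have hll' : p.σ₀ * l ≤ p.σ₀ * l ^ 4 := by gcongr
      have hl5 : 5 * (p.σ₀ * l ^ 4) ≤ p.σ₀ * l ^ 5 := by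
        calc _ ≤ l * (p.σ₀ * l ^ 4) := by gcongr
          _ = _ := by ring
      refine hG.abs_relGrad_le hq hb (hI t) (by linarith) (fun i => (hn i).trans ?_) k
      have e1 : 3 * l ^ 4 * (Real.sqrt p.s * p.σp * p.σ₀) ≤ 3 * l ^ 4 * (1 * p.σ₀) := by
        gcongr
        exact hb.sqrt_s_σp_le
      have e2 : p.α * (2 * (p.σ₀ * l)) ≤ 1 * (2 * (p.σ₀ * l)) := by
        gcongr
        exact hb.α_le
      linarith
  exact fun t ht j r => step t ht j r fun τ hτ k => hrel τ (by omega) j r k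

/-! ### The probability of the good event -/

instance (d : ℕ) (σ : ℝ) : IsProbabilityMeasure (isoGaussian d σ) := by
  unfold isoGaussian; infer_instance

theorem hasSubgaussianMGF_gaussianReal (v : NNReal) :
    HasSubgaussianMGF (fun x => x) v (gaussianReal 0 v) where
  integrable_exp_mul t := integrable_exp_mul_gaussianReal t
  mgf_le t := by rw [mgf_fun_id_gaussianReal]; simp

theorem hasSubgaussianMGF_isoGaussian (d : ℕ) (σ : ℝ) (a : Fin d → ℝ) :
    HasSubgaussianMGF (fun z => ∑ k, a k * z k)
      (∑ k, Real.toNNReal (a k ^ 2) * Real.toNNReal (σ ^ 2)) (isoGaussian d σ) := by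
  refine HasSubgaussianMGF.sum_of_iIndepFun (X := fun k (z : Fin d → ℝ) => a k * z k) ?_
    fun k _ => ?_
  · exact iIndepFun_pi (X := fun k x => a k * x) fun k => (measurable_const_mul _).aemeasurable
  · refine HasSubgaussianMGF.of_map (Y := fun z : Fin d → ℝ => z k) (X := fun x => a k * x)
      (measurable_pi_apply k).aemeasurable ?_
    rw [show Measure.map (fun z : Fin d → ℝ => z k) (isoGaussian d σ) =
      gaussianReal 0 (Real.toNNReal (σ ^ 2)) from (measurePreserving_eval _ k).map_eq]
    rw [Real.toNNReal_of_nonneg (sq_nonneg (a k))]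
    exact (hasSubgaussianMGF_gaussianReal _).const_mul _

/-- The Gaussian tail bound for linear forms. -/
theorem isoGaussian_linear_tail {d : ℕ} {σ v l : ℝ} (hσ : 0 < σ) (hv : 0 < v) (hl : 0 ≤ l)
    {a : Fin d → ℝ} (ha : ∑ k, a k ^ 2 ≤ v ^ 2) :
    isoGaussian d σ {z | σ * v * l < |∑ k, a k * z k|} ≤
      ENNReal.ofReal (2 * Real.exp (-l ^ 2 / 2)) := by
  have one : ∀ a : Fin d → ℝ, ∑ k, a k ^ 2 ≤ v ^ 2 →
      isoGaussian d σ {z | σ * v * l < ∑ k, a k * z k} ≤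
        ENNReal.ofReal (Real.exp (-l ^ 2 / 2)) := by
    intro a ha
    have hx : 0 ≤ σ * v * l := by positivity
    have h := (hasSubgaussianMGF_isoGaussian d σ a).measure_ge_le hx
    set c := ∑ k, Real.toNNReal (a k ^ 2) * Real.toNNReal (σ ^ 2) with hc
    have hcr : (c : ℝ) = (∑ k, a k ^ 2) * σ ^ 2 := by
      rw [hc, NNReal.coe_sum, Finset.sum_mul]
      refine Finset.sum_congr rfl fun k _ => ?_
      rw [NNReal.coe_mul, Real.coe_toNNReal _ (sq_nonneg σ), Real.coe_toNNReal _ (sq_nonneg _)]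
    have hsum : 0 ≤ ∑ k, a k ^ 2 := Finset.sum_nonneg fun _ _ => sq_nonneg _
    rcases hsum.eq_or_lt with h0 | h0
    · -- the zero form, for which the Chernoff bound divides by zero
      have hz : ∀ k, a k = 0 := fun k => by
        have := (Finset.sum_eq_zero_iff_of_nonneg fun _ _ => sq_nonneg _).1 h0.symm k
          (Finset.mem_univ k)
        exact pow_eq_zero_iff two_ne_zero |>.1 this
      have : {z : Fin d → ℝ | σ * v * l < ∑ k, a k * z k} = ∅ := by
        ext z
        simp [hz, hx]
      rw [this, measure_empty]
      exact zero_le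
    · have hle : Real.exp (-(σ * v * l) ^ 2 / (2 * c)) ≤ Real.exp (-l ^ 2 / 2) := by
        rw [Real.exp_le_exp, hcr, neg_div, neg_div, neg_le_neg_iff, le_div_iff₀ (by positivity)]
        calc l ^ 2 / 2 * (2 * ((∑ k, a k ^ 2) * σ ^ 2))
            = l ^ 2 * σ ^ 2 * (∑ k, a k ^ 2) := by ring
          _ ≤ l ^ 2 * σ ^ 2 * v ^ 2 := by gcongr
          _ = _ := by ring
      have hmono : {z : Fin d → ℝ | σ * v * l < ∑ k, a k * z k} ⊆
          {z | σ * v * l ≤ ∑ k, a k * z k} := by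
        intro z hz
        simp only [Set.mem_ofPred_eq] at hz ⊢
        exact hz.le
      calc _ ≤ isoGaussian d σ {z | σ * v * l ≤ ∑ k, a k * z k} := measure_mono hmono
        _ = ENNReal.ofReal ((isoGaussian d σ).real {z | σ * v * l ≤ ∑ k, a k * z k}) := by
            rw [ofReal_measureReal]
        _ ≤ _ := ENNReal.ofReal_le_ofReal (h.trans hle)
  have hsub : {z : Fin d → ℝ | σ * v * l < |∑ k, a k * z k|} ⊆
      {z | σ * v * l < ∑ k, a k * z k} ∪ {z | σ * v * l < ∑ k, (-a) k * z k} := by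
    intro z hz
    have hz' : σ * v * l < |∑ k, a k * z k| := hz
    rcases lt_abs.1 hz' with h | h
    · exact Or.inl h
    · right
      simpa [Finset.sum_neg_distrib] using h
  refine (measure_mono hsub).trans ((measure_union_le _ _).trans ?_)
  rw [two_mul, ENNReal.ofReal_add (by positivity) (by positivity)]
  exact add_le_add (one a ha) (one (-a) (by simpa using ha))

theorem isoGaussian_coord_tail {d : ℕ} {σ l : ℝ} (hσ : 0 < σ) (hl : 0 ≤ l) (k : Fin d) :
    isoGaussian d σ {z | σ * l < |z k|} ≤ ENNReal.ofReal (2 * Real.exp (-l ^ 2 / 2)) := by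
  have h := isoGaussian_linear_tail (a := Pi.single k 1) hσ one_pos hl
    (by simp [Pi.single_apply])
  simpa [Pi.single_apply] using h

section
variable {α β : Type*} [MeasurableSpace α] [MeasurableSpace β] {μ : Measure α} {ν : Measure β}
  {E : Set (α × β)} {δ : ENNReal}

theorem prod_le_of_section_le [SFinite ν] [IsProbabilityMeasure μ] (hE : MeasurableSet E)
    (h : ∀ x, ν {y | (x, y) ∈ E} ≤ δ) : μ.prod ν E ≤ δ := by
  rw [Measure.prod_apply hE]
  exact (lintegral_mono h).trans (by simp)

theorem prod_le_of_section_le' [SFinite μ] [IsProbabilityMeasure ν] (hE : MeasurableSet E)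
    (h : ∀ y, μ {x | (x, y) ∈ E} ≤ δ) : μ.prod ν E ≤ δ := by
  rw [Measure.prod_apply_symm hE]
  exact (lintegral_mono h).trans (by simp)
end

theorem noiseMasks_nonempty {d s : ℕ} (h : s + 1 ≤ d) : (noiseMasks d s).Nonempty := by
  obtain ⟨d, rfl⟩ : ∃ d', d = d' + 1 := ⟨d - 1, by omega⟩
  obtain ⟨t, ht, hc⟩ := Finset.exists_subset_card_eq
    (show s ≤ ((Finset.univ : Finset (Fin (d + 1))).erase 0).card by
      rw [Finset.card_erase_of_mem (Finset.mem_univ _), Finset.card_univ, Fintype.card_fin]; omega)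
  refine ⟨fun k => decide (k ∈ t), fun k hk => ?_, ?_⟩
  · have : k = 0 := Fin.ext hk
    subst this
    simpa using fun h => Finset.ne_of_mem_erase (ht h) rfl
  · rw [← hc]
    congr 1
    ext k
    simp

section
variable {d s : ℕ} {σ : ℝ}

theorem isProbabilityMeasure_noiseMasks (h : s + 1 ≤ d) :
    IsProbabilityMeasure (uniformOn (noiseMasks d s)) :=
  isProbabilityMeasure_uniformOn (Set.toFinite _) (noiseMasks_nonempty h)

instance : IsProbabilityMeasure (uniformOn (Set.univ : Set ℤˣ)) :=
  isProbabilityMeasure_uniformOn (Set.toFinite _) Set.univ_nonempty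

instance : IsProbabilityMeasure (uniformOn (Set.univ : Set Bool)) :=
  isProbabilityMeasure_uniformOn (Set.toFinite _) Set.univ_nonempty

theorem isProbabilityMeasure_drawLaw (h : s + 1 ≤ d) : IsProbabilityMeasure (drawLaw d s σ) := by
  have := isProbabilityMeasure_noiseMasks h
  unfold drawLaw
  infer_instance

theorem drawLaw_gauss_tail (h : s + 1 ≤ d) {l : ℝ} (hσ : 0 < σ) (hl : 0 ≤ l) (k : Fin d) :
    drawLaw d s σ {ω | σ * l < |ω.2.2.2 k|} ≤ ENNReal.ofReal (2 * Real.exp (-l ^ 2 / 2)) := by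
  have := isProbabilityMeasure_noiseMasks h
  have hE : MeasurableSet {z : Fin d → ℝ | σ * l < |z k|} :=
    measurableSet_lt measurable_const (measurable_pi_apply k).abs
  have hp : MeasurePreserving (fun ω : Draw d => ω.2.2.2) (drawLaw d s σ) (isoGaussian d σ) :=
    measurePreserving_snd.comp (measurePreserving_snd.comp measurePreserving_snd)
  exact (hp.measure_preimage hE.nullMeasurableSet).trans_le (isoGaussian_coord_tail hσ hl k)

theorem drawLaw_mask (h : s + 1 ≤ d) :
    drawLaw d s σ {ω | ω.2.2.1 ∉ noiseMasks d s} = 0 := by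
  have := isProbabilityMeasure_noiseMasks h
  have hp : MeasurePreserving (fun ω : Draw d => ω.2.2.1) (drawLaw d s σ)
      (uniformOn (noiseMasks d s)) :=
    measurePreserving_fst.comp (measurePreserving_snd.comp measurePreserving_snd)
  refine (hp.measure_preimage (s := (noiseMasks d s)ᶜ)
    (Set.toFinite _).measurableSet.nullMeasurableSet).trans ?_
  rw [uniformOn_eq_zero_iff (Set.toFinite _), Set.inter_compl_self]

theorem measurable_softThreshold (c : ℝ) : Measurable (softThreshold c) := by
  unfold softThreshold
  fun_prop

/-- Given the initial weights and the mask, the inner product of the noise vector with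
the soft-thresholded weights is a Gaussian linear form. -/
theorem prod_inner_tail (h : s + 1 ≤ d) (hs : 1 ≤ s) {σ₀ l c : ℝ} (hσ : 0 < σ) (hσ₀ : 0 < σ₀)
    (hl : 0 < l) (hc : 0 ≤ c) :
    (drawLaw d s σ).prod (isoGaussian d σ₀) {x | (∀ k, |x.2 k| ≤ σ₀ * l) ∧
      x.1.2.2.1 ∈ noiseMasks d s ∧ Real.sqrt s * σ * σ₀ * l ^ 2 <
        |∑ k, (if x.1.2.2.1 k then softThreshold c (x.2 k) else 0) * x.1.2.2.2 k|} ≤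
      ENNReal.ofReal (2 * Real.exp (-l ^ 2 / 2)) := by
  have := isProbabilityMeasure_noiseMasks h
  have := isProbabilityMeasure_drawLaw (σ := σ) h
  have hmk : ∀ k : Fin d, Measurable fun x : Draw d × (Fin d → ℝ) => x.2 k := fun k => by fun_prop
  have hE : MeasurableSet {x : Draw d × (Fin d → ℝ) | (∀ k, |x.2 k| ≤ σ₀ * l) ∧
      x.1.2.2.1 ∈ noiseMasks d s ∧ Real.sqrt s * σ * σ₀ * l ^ 2 <
        |∑ k, (if x.1.2.2.1 k then softThreshold c (x.2 k) else 0) * x.1.2.2.2 k|} := by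
    have m1 : MeasurableSet {x : Draw d × (Fin d → ℝ) | ∀ k, |x.2 k| ≤ σ₀ * l} := by
      have : {x : Draw d × (Fin d → ℝ) | ∀ k, |x.2 k| ≤ σ₀ * l} =
          ⋂ k, {x | |x.2 k| ≤ σ₀ * l} := by ext; simp
      rw [this]
      exact MeasurableSet.iInter fun k => measurableSet_le (hmk k).abs measurable_const
    have m2 : MeasurableSet {x : Draw d × (Fin d → ℝ) | x.1.2.2.1 ∈ noiseMasks d s} := by
      have hm : Measurable fun x : Draw d × (Fin d → ℝ) => x.1.2.2.1 := by fun_prop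
      exact hm (Set.toFinite (noiseMasks d s)).measurableSet
    have m3 : MeasurableSet {x : Draw d × (Fin d → ℝ) | Real.sqrt s * σ * σ₀ * l ^ 2 <
        |∑ k, (if x.1.2.2.1 k then softThreshold c (x.2 k) else 0) * x.1.2.2.2 k|} := by
      have hm : Measurable fun x : Draw d × (Fin d → ℝ) =>
          ∑ k, (if x.1.2.2.1 k then softThreshold c (x.2 k) else 0) * x.1.2.2.2 k := by
        refine Finset.measurable_fun_sum _ fun k _ => Measurable.mul ?_ (by fun_prop)
        refine Measurable.ite ?_ ((measurable_softThreshold c).comp (hmk k)) measurable_const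
        have hm : Measurable fun x : Draw d × (Fin d → ℝ) => x.1.2.2.1 k := by fun_prop
        exact hm (MeasurableSet.singleton true)
      exact measurableSet_lt measurable_const hm.abs
    exact m1.inter (m2.inter m3)
  refine prod_le_of_section_le' hE fun w => ?_
  have hE1 := measurable_prodMk_right (y := w) hE
  refine prod_le_of_section_le hE1 fun y => ?_
  have hE2 := measurable_prodMk_left (x := y) hE1
  refine prod_le_of_section_le hE2 fun o => ?_
  have hE3 := measurable_prodMk_left (x := o) hE2
  refine prod_le_of_section_le hE3 fun b => ?_
  by_cases hw : ∀ k, |w k| ≤ σ₀ * l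
  · by_cases hb : b ∈ noiseMasks d s
    · have hsq : (0 : ℝ) < Real.sqrt s := Real.sqrt_pos.2 (by exact_mod_cast hs)
      have ha : ∑ k, (if b k then softThreshold c (w k) else 0) ^ 2 ≤
          (Real.sqrt s * σ₀ * l) ^ 2 := by
        calc _ ≤ ∑ k, if b k = true then (σ₀ * l) ^ 2 else 0 := by
              refine Finset.sum_le_sum fun k _ => ?_
              split_ifs
              · rw [← sq_abs]
                gcongr
                exact (abs_softThreshold_le hc _).trans (hw k)
              · simp
          _ = (Real.sqrt s * σ₀ * l) ^ 2 := by
              rw [← Finset.sum_filter, Finset.sum_const, hb.2, nsmul_eq_mul, mul_assoc, mul_pow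
                (Real.sqrt s), Real.sq_sqrt (Nat.cast_nonneg _)]
      refine (measure_mono ?_).trans
        (isoGaussian_linear_tail hσ (v := Real.sqrt s * σ₀ * l) (by positivity) hl.le ha)
      rintro z ⟨-, -, hz⟩
      refine lt_of_eq_of_lt ?_ hz
      ring
    · refine (measure_mono (t := ∅) ?_).trans (by simp)
      rintro z ⟨-, hz, -⟩
      exact hb hz
  · refine (measure_mono (t := ∅) ?_).trans (by simp)
    rintro z ⟨hz, -, -⟩
    exact hw hz

end

/-- The union bound for the good event. -/
theorem trainLaw_not_goodEvent_le {n N : ℕ} {p : Params} {c : ℕ → ℝ} {l : ℝ} (h : p.s + 1 ≤ p.d)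
    (hs : 1 ≤ p.s) (hσ : 0 < p.σp) (hσ₀ : 0 < p.σ₀) (hl : 0 < l) (hc : ∀ t, 0 ≤ c t) :
    trainLaw n p {ω | ¬ GoodEvent p N c l ω.1 ω.2} ≤
      ENNReal.ofReal ((2 * p.m * p.d + n * p.d + (N + 1) * (2 * p.m * n)) *
        (2 * Real.exp (-l ^ 2 / 2))) := by
  have := isProbabilityMeasure_drawLaw (σ := p.σp) h
  set δ := ENNReal.ofReal (2 * Real.exp (-l ^ 2 / 2)) with hδ
  -- one bad event for each condition of the good event; those of the masks are null sets
  set E₁ : ℤˣ × Fin p.m × Fin p.d → Set ((Fin n → Draw p.d) × Weights p.m p.d) :=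
    fun x => {ω | p.σ₀ * l < |ω.2 x.1 x.2.1 x.2.2|} with hE₁
  set E₂ : Fin n × Fin p.d → Set ((Fin n → Draw p.d) × Weights p.m p.d) :=
    fun x => {ω | p.σp * l < |(ω.1 x.1).2.2.2 x.2|} with hE₂
  set E₃ : Fin n → Set ((Fin n → Draw p.d) × Weights p.m p.d) :=
    fun i => {ω | (ω.1 i).2.2.1 ∉ noiseMasks p.d p.s} with hE₃
  set E₄ : Fin (N + 1) × ℤˣ × Fin p.m × Fin n → Set ((Fin n → Draw p.d) × Weights p.m p.d) :=
    fun x => {ω | (∀ k, |ω.2 x.2.1 x.2.2.1 k| ≤ p.σ₀ * l) ∧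
      (ω.1 x.2.2.2).2.2.1 ∈ noiseMasks p.d p.s ∧ Real.sqrt p.s * p.σp * p.σ₀ * l ^ 2 <
        |∑ k, (if (ω.1 x.2.2.2).2.2.1 k then softThreshold (c x.1) (ω.2 x.2.1 x.2.2.1 k) else 0) *
          (ω.1 x.2.2.2).2.2.2 k|} with hE₄
  have hsub : {ω | ¬ GoodEvent p N c l ω.1 ω.2} ⊆
      ((⋃ x, E₁ x) ∪ ⋃ x, E₂ x) ∪ ((⋃ x, E₃ x) ∪ ⋃ x, E₄ x) := by
    intro ω hω
    by_contra hn
    simp only [Set.mem_union, Set.mem_iUnion, not_or, not_exists] at hn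
    obtain ⟨⟨n1, n2⟩, n3, n4⟩ := hn
    have f1 : ∀ j r k, |ω.2 j r k| ≤ p.σ₀ * l := fun j r k => not_lt.1 (n1 (j, r, k))
    have f3 : ∀ i, (ω.1 i).2.2.1 ∈ noiseMasks p.d p.s := fun i => not_not.1 (n3 i)
    exact hω ⟨f1, fun i k => not_lt.1 (n2 (i, k)), f3, fun t ht j r i => not_lt.1 fun hlt =>
      n4 (⟨t, by omega⟩, j, r, i) ⟨f1 j r, f3 i, hlt⟩⟩
  have hW : ∀ j r, MeasurePreserving (fun ω : (Fin n → Draw p.d) × Weights p.m p.d => ω.2 j r)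
      (trainLaw n p) (isoGaussian p.d p.σ₀) := fun j r =>
    (measurePreserving_eval (fun _ : Fin p.m => isoGaussian p.d p.σ₀) r).comp
      ((measurePreserving_eval (fun _ : ℤˣ => Measure.pi fun _ : Fin p.m =>
        isoGaussian p.d p.σ₀) j).comp measurePreserving_snd)
  have hS : ∀ i, MeasurePreserving (fun ω : (Fin n → Draw p.d) × Weights p.m p.d => ω.1 i)
      (trainLaw n p) (drawLaw p.d p.s p.σp) := fun i =>
    (measurePreserving_eval (fun _ : Fin n => drawLaw p.d p.s p.σp) i).comp measurePreserving_fst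
  have hSW : ∀ i j r, MeasurePreserving
      (fun ω : (Fin n → Draw p.d) × Weights p.m p.d => (ω.1 i, ω.2 j r))
      (trainLaw n p) ((drawLaw p.d p.s p.σp).prod (isoGaussian p.d p.σ₀)) := fun i j r =>
    (measurePreserving_eval (fun _ : Fin n => drawLaw p.d p.s p.σp) i).prod
      ((measurePreserving_eval (fun _ : Fin p.m => isoGaussian p.d p.σ₀) r).comp
        (measurePreserving_eval (fun _ : ℤˣ => Measure.pi fun _ : Fin p.m =>
          isoGaussian p.d p.σ₀) j))
  have b1 : ∀ x, trainLaw n p (E₁ x) ≤ δ := fun x =>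
    ((hW x.1 x.2.1).measure_preimage_le _).trans (isoGaussian_coord_tail hσ₀ hl.le x.2.2)
  have b2 : ∀ x, trainLaw n p (E₂ x) ≤ δ := fun x =>
    ((hS x.1).measure_preimage_le _).trans (drawLaw_gauss_tail h hσ hl.le x.2)
  have b3 : ∀ x, trainLaw n p (E₃ x) ≤ 0 := fun x =>
    ((hS x).measure_preimage_le _).trans (drawLaw_mask h).le
  have b4 : ∀ x, trainLaw n p (E₄ x) ≤ δ := fun x =>
    ((hSW x.2.2.2 x.2.1 x.2.2.1).measure_preimage_le _).trans
      (prod_inner_tail h hs hσ hσ₀ hl (hc x.1))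
  have key : ∀ {ι : Type} [Fintype ι] (E : ι → Set ((Fin n → Draw p.d) × Weights p.m p.d))
      (b : ENNReal), (∀ x, trainLaw n p (E x) ≤ b) →
      trainLaw n p (⋃ x, E x) ≤ Fintype.card ι * b := by
    intro ι _ E b hb
    refine (measure_iUnion_fintype_le _ _).trans ((Finset.sum_le_sum fun x _ => hb x).trans ?_)
    simp
  have hcard : ∀ a : ℕ, (a : ENNReal) * δ = ENNReal.ofReal (a * (2 * Real.exp (-l ^ 2 / 2))) :=
    fun a => by rw [hδ, ENNReal.ofReal_mul (Nat.cast_nonneg _), ENNReal.ofReal_natCast]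
  calc _ ≤ _ := measure_mono hsub
    _ ≤ (trainLaw n p (⋃ x, E₁ x) + trainLaw n p (⋃ x, E₂ x)) +
        (trainLaw n p (⋃ x, E₃ x) + trainLaw n p (⋃ x, E₄ x)) :=
      (measure_union_le _ _).trans (add_le_add (measure_union_le _ _) (measure_union_le _ _))
    _ ≤ _ := add_le_add (add_le_add (key E₁ δ b1) (key E₂ δ b2))
        (add_le_add (key E₃ 0 b3) (key E₄ δ b4))
    _ = _ := by
      rw [mul_zero, zero_add, ← add_mul, ← add_mul, ← Nat.cast_add, ← Nat.cast_add, hcard]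
      congr 2
      simp only [Fintype.card_prod, Fintype.card_fin, Fintype.card_units_int]
      push_cast
      ring

/-! ### The asymptotic regime -/

theorem tendsto_log_natCast : Tendsto (fun n : ℕ => Real.log n) atTop atTop :=
  Real.tendsto_log_atTop.comp tendsto_natCast_atTop_atTop

theorem eventually_le_log (K : ℝ) : ∀ᶠ n : ℕ in atTop, K ≤ Real.log n :=
  tendsto_log_natCast.eventually_ge_atTop K

theorem natCast_rpow_eq_exp {n : ℕ} (hn : 1 ≤ n) (D : ℝ) :
    (n : ℝ) ^ D = Real.exp (D * Real.log n) := by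
  rw [Real.rpow_def_of_pos (by exact_mod_cast hn), mul_comm]

theorem le_exp_self (x : ℝ) : x ≤ Real.exp x := by linarith [Real.add_one_le_exp x]

theorem IsPolyGrowth.exists_le_exp {a : ℕ → ℝ} (h : IsPolyGrowth a) :
    ∃ D : ℝ, ∀ᶠ n : ℕ in atTop, a n ≤ Real.exp (D * Real.log n) := by
  obtain ⟨D, -, hD⟩ := h
  obtain ⟨c, -, hb⟩ := hD.1.exists_pos
  refine ⟨D + 1, ?_⟩
  filter_upwards [hb.bound, eventually_le_log c, eventually_ge_atTop 1] with n h1 h2 h3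
  rw [natCast_rpow_eq_exp h3, Real.norm_eq_abs, Real.norm_eq_abs, Real.abs_exp] at h1
  calc a n ≤ |a n| := le_abs_self _
    _ ≤ c * Real.exp (D * Real.log n) := h1
    _ ≤ Real.exp (Real.log n) * Real.exp (D * Real.log n) := by
        gcongr
        exact h2.trans (le_exp_self _)
    _ = _ := by rw [← Real.exp_add]; ring_nf

theorem IsPolyGrowth.tendsto_abs {a : ℕ → ℝ} (h : IsPolyGrowth a) :
    Tendsto (fun n => |a n|) atTop atTop := by
  obtain ⟨D, hD0, hD⟩ := h
  obtain ⟨c, hc, hb⟩ := hD.2.exists_pos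
  have ht : Tendsto (fun n : ℕ => c⁻¹ * (n : ℝ) ^ D) atTop atTop :=
    ((tendsto_rpow_atTop hD0).comp tendsto_natCast_atTop_atTop).const_mul_atTop (inv_pos.2 hc)
  refine tendsto_atTop_mono' _ ?_ ht
  filter_upwards [hb.bound] with n h1
  rw [inv_mul_le_iff₀ hc]
  simpa [abs_of_nonneg (Real.rpow_nonneg (Nat.cast_nonneg n) D)] using h1

theorem IsPolylogGrowth.tendsto_abs {a : ℕ → ℝ} (h : IsPolylogGrowth a) :
    Tendsto (fun n => |a n|) atTop atTop := by
  obtain ⟨D, hD0, hD⟩ := h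
  obtain ⟨c, hc, hb⟩ := hD.2.exists_pos
  have ht : Tendsto (fun n : ℕ => c⁻¹ * Real.log n ^ D) atTop atTop :=
    ((tendsto_rpow_atTop hD0).comp tendsto_log_natCast).const_mul_atTop (inv_pos.2 hc)
  refine tendsto_atTop_mono' _ ?_ ht
  filter_upwards [hb.bound, eventually_le_log 0] with n h1 h2
  rw [inv_mul_le_iff₀ hc]
  simpa [abs_of_nonneg (Real.rpow_nonneg h2 D)] using h1

theorem IsPolylogGrowth.exists_le {a : ℕ → ℝ} (h : IsPolylogGrowth a) :
    ∃ K D : ℝ, 0 < K ∧ 0 < D ∧ ∀ᶠ n : ℕ in atTop, |a n| ≤ K * Real.log n ^ D := by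
  obtain ⟨D, hD0, hD⟩ := h
  obtain ⟨c, hc, hb⟩ := hD.1.exists_pos
  refine ⟨c, D, hc, hD0, ?_⟩
  filter_upwards [hb.bound, eventually_le_log 0] with n h1 h2
  simpa [abs_of_nonneg (Real.rpow_nonneg h2 D)] using h1

theorem IsPolylogGrowth.eventually_le_exp {a : ℕ → ℝ} (h : IsPolylogGrowth a) :
    ∀ᶠ n : ℕ in atTop, a n ≤ Real.exp (Real.log n) := by
  obtain ⟨D, -, hD⟩ := h
  have h1 : (fun n : ℕ => Real.log n ^ D) =o[atTop] fun n : ℕ => Real.exp (1 * Real.log n) :=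
    (isLittleO_rpow_exp_pos_mul_atTop D one_pos).comp_tendsto tendsto_log_natCast
  filter_upwards [(hD.1.trans_isLittleO h1).bound one_pos] with n h2
  have := (le_abs_self (a n)).trans h2
  simpa [abs_of_pos (Real.exp_pos _)] using this

section
variable {q : ℝ} {P : ℕ → Params}

theorem AdamRegime.tendsto_d (h : AdamRegime q P) :
    Tendsto (fun n => ((P n).d : ℝ)) atTop atTop := by
  simpa using h.d_poly.tendsto_abs

theorem AdamRegime.eventually_s_pos (h : AdamRegime q P) : ∀ᶠ n in atTop, 1 ≤ (P n).s := by
  obtain ⟨c, hc, hb⟩ := h.s_theta.2.exists_pos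
  filter_upwards [hb.bound, h.tendsto_d.eventually_ge_atTop 1, eventually_ge_atTop 1]
    with n h1 h2 h3
  by_contra h0
  have h0 : (P n).s = 0 := by omega
  have hn : (0 : ℝ) < n := by exact_mod_cast h3
  have hpos : 0 < ((P n).d : ℝ) ^ (1 / 2 : ℝ) / (n : ℝ) ^ 2 := by positivity
  rw [h0, Real.norm_of_nonneg hpos.le] at h1
  simp only [Nat.cast_zero, norm_zero, mul_zero] at h1
  linarith

theorem AdamRegime.eventually_s_lt_d (h : AdamRegime q P) :
    ∀ᶠ n in atTop, (P n).s + 1 ≤ (P n).d := by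
  obtain ⟨c, hc, hb⟩ := h.s_theta.1.exists_pos
  have hn2 : Tendsto (fun n : ℕ => (n : ℝ)) atTop atTop := tendsto_natCast_atTop_atTop
  filter_upwards [hb.bound, h.tendsto_d.eventually_ge_atTop 2,
    hn2.eventually_ge_atTop (2 * c), hn2.eventually_ge_atTop 1] with n h1 h2 h3 h4
  have hd : ((P n).d : ℝ) ^ (1 / 2 : ℝ) ≤ (P n).d := by
    conv_rhs => rw [← Real.rpow_one ((P n).d : ℝ)]
    exact Real.rpow_le_rpow_of_exponent_le (by linarith) (by norm_num)
  have hpos : 0 ≤ ((P n).d : ℝ) ^ (1 / 2 : ℝ) / (n : ℝ) ^ 2 := by positivity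
  rw [Real.norm_of_nonneg hpos, Real.norm_of_nonneg (Nat.cast_nonneg _)] at h1
  have h5 : ((P n).s : ℝ) ≤ (P n).d / 2 := by
    refine h1.trans ?_
    rw [← mul_div_assoc, div_le_iff₀ (by positivity)]
    calc c * ((P n).d : ℝ) ^ (1 / 2 : ℝ) ≤ (n / 2) * (P n).d := by gcongr; linarith
      _ ≤ (n ^ 2 / 2) * (P n).d := by gcongr; nlinarith
      _ = _ := by ring
  have h6 : ((P n).s : ℝ) + 1 ≤ (P n).d := by linarith
  exact_mod_cast h6

theorem AdamRegime.eventually_s_σp_le (h : AdamRegime q P) :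
    ∀ᶠ n in atTop, ((P n).s : ℝ) * (P n).σp ^ 2 ≤ 1 := by
  obtain ⟨a, ha, hθ⟩ := h.σp_theta
  obtain ⟨c, hc, hb⟩ := hθ.1.exists_pos
  filter_upwards [hb.bound, ha.tendsto_abs.eventually_ge_atTop (max c 1),
    h.eventually_s_pos] with n h1 h2 h3
  have hs : (0 : ℝ) < (P n).s := by exact_mod_cast h3
  have ha0 : 0 < |a n| := lt_of_lt_of_le one_pos ((le_max_right _ _).trans h2)
  rw [Real.norm_of_nonneg (sq_nonneg _), norm_div, norm_mul, norm_one,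
    Real.norm_of_nonneg hs.le, Real.norm_eq_abs] at h1
  calc ((P n).s : ℝ) * (P n).σp ^ 2 ≤ (P n).s * (c * (1 / ((P n).s * |a n|))) := by gcongr
    _ = c / |a n| := by field_simp
    _ ≤ 1 := (div_le_one ha0).2 ((le_max_left _ _).trans h2)

theorem AdamRegime.eventually_σp_le (h : AdamRegime q P) : ∀ᶠ n in atTop, (P n).σp ≤ 1 := by
  filter_upwards [h.eventually_s_σp_le, h.eventually_s_pos, h.pos] with n h1 h2 h3
  have hs : (1 : ℝ) ≤ (P n).s := by exact_mod_cast h2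
  have : (P n).σp ^ 2 ≤ 1 := (le_mul_of_one_le_left (sq_nonneg _) hs).trans h1
  exact (sq_le_one_iff₀ h3.1.le).1 this

theorem AdamRegime.eventually_σ₀_le (h : AdamRegime q P) : ∀ᶠ n in atTop, (P n).σ₀ ≤ 1 := by
  have ht : Tendsto (fun n => ((P n).d : ℝ) ^ (-(1 / 4) : ℝ)) atTop (nhds 0) :=
    (tendsto_rpow_neg_atTop (by norm_num)).comp h.tendsto_d
  filter_upwards [(h.σ₀_theta.1.trans_tendsto ht).eventually_le_const one_pos] with n h1 using h1

theorem AdamRegime.exists_α_le (h : AdamRegime q P) : ∃ K D : ℝ, 0 < K ∧ 0 < D ∧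
    ∀ᶠ n : ℕ in atTop, (P n).α ≤ K * Real.log n ^ D * (P n).σp := by
  obtain ⟨a, ha, hθ⟩ := h.α_theta
  obtain ⟨c, hc, hb⟩ := hθ.1.exists_pos
  obtain ⟨K, D, hK, hD, hle⟩ := ha.exists_le
  refine ⟨c * K, D, by positivity, hD, ?_⟩
  filter_upwards [hb.bound, hle, h.pos] with n h1 h2 h3
  have hσ := h3.1
  rw [norm_mul, Real.norm_of_nonneg hσ.le, Real.norm_eq_abs, Real.norm_eq_abs] at h1
  calc (P n).α ≤ |(P n).α| := le_abs_self _
    _ ≤ c * ((P n).σp * |a n|) := h1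
    _ ≤ c * ((P n).σp * (K * Real.log n ^ D)) := by gcongr
    _ = _ := by ring

/-- The learning rate is negligible against `σ₀ σp`, the scale of the perturbation in the noise
coordinates. -/
theorem AdamRegime.eventually_η_le (hq : 1 ≤ q) (h : AdamRegime q P) {k : ℝ} (hk : 0 < k) :
    ∀ᶠ n in atTop, (P n).η ≤ k * ((P n).σ₀ * (P n).σp) := by
  filter_upwards [h.η_small.bound hk, h.pos, h.eventually_σ₀_le, h.eventually_σp_le]
    with n h1 h2 h3 h4
  obtain ⟨p1, -, -, p2, p3, p4, -⟩ := h2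
  have hm : 0 < min (P n).lam 1 := lt_min p4 one_pos
  rw [Real.norm_of_nonneg p3.le, Real.norm_of_nonneg (by positivity)] at h1
  have e1 : (P n).σ₀ ^ q ≤ (P n).σ₀ := Real.rpow_le_self_of_le_one p2.le h3 hq
  have e2 : (P n).σp ^ q ≤ (P n).σp := Real.rpow_le_self_of_le_one p1.le h4 hq
  refine h1.trans (mul_le_mul_of_nonneg_left ?_ hk.le)
  calc min (P n).lam 1 * (P n).σ₀ ^ q * (P n).σp ^ q ≤ 1 * (P n).σ₀ * (P n).σp := by
        gcongr
        exact min_le_right _ _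
    _ = _ := by ring

theorem AdamRegime.eventually_ε_le (hq : 1 ≤ q) (h : AdamRegime q P) :
    ∀ᶠ n in atTop, (P n).ε / (P n).lam ≤ (P n).σ₀ * (P n).σp := by
  obtain ⟨c, hc, hb⟩ := h.ε_theta.1.exists_pos
  filter_upwards [hb.bound, h.pos, h.eventually_η_le hq (inv_pos.2 hc)] with n h1 h2 h3
  obtain ⟨p1, -, -, p2, p3, p4, p5⟩ := h2
  rw [Real.norm_of_nonneg p5.le, Real.norm_of_nonneg (by positivity)] at h1
  rw [div_le_iff₀ p4]
  calc (P n).ε ≤ c * ((P n).lam * (P n).η) := h1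
    _ ≤ c * ((P n).lam * (c⁻¹ * ((P n).σ₀ * (P n).σp))) := by gcongr
    _ = _ := by field_simp

/-- The initial weights exceed `σ₀ σp` by a factor of at most `exp ((log n)²)`, so that the logarithm
in the comparison with soft thresholding is at most `(log n)²`. The bound is crude: `σp` is at least
`η`, an inverse polynomial. -/
theorem AdamRegime.eventually_exp_ge (hq : 1 ≤ q) (h : AdamRegime q P) :
    ∀ᶠ n : ℕ in atTop, Real.log n ≤ Real.exp (Real.log n ^ 2) * (P n).σp := by
  obtain ⟨D, hD⟩ := h.η_inv_poly.exists_le_exp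
  filter_upwards [hD, h.pos, h.eventually_η_le hq one_pos, h.eventually_σ₀_le,
    eventually_le_log (D + 1), eventually_le_log 0] with n h1 h2 h3 h4 h5 h6
  obtain ⟨p1, -, -, p2, p3, p4, p5⟩ := h2
  set l := Real.log n
  have hη : (P n).η ≤ (P n).σp := by
    rw [one_mul] at h3
    exact h3.trans (mul_le_of_le_one_left p1.le h4)
  have h7 : 1 ≤ Real.exp (D * l) * (P n).σp := by
    rw [div_le_iff₀ p3] at h1
    exact h1.trans (by gcongr)
  calc l ≤ Real.exp l * (Real.exp (D * l) * (P n).σp) := by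
        nlinarith [le_exp_self l, Real.exp_pos l]
    _ = Real.exp (l + D * l) * (P n).σp := by rw [Real.exp_add]; ring
    _ ≤ _ := by
        gcongr
        nlinarith

/-- The only place where the size of the weight decay enters. -/
theorem eventually_grad_le (hq : 1 < q) (h : AdamRegime q P)
    (hlam : (fun n : ℕ => (P n).σ₀ ^ (q - 2) * Real.log n ^ (5 * q)) =o[atTop]
      fun n => (P n).lam) :
    ∀ᶠ n : ℕ in atTop, 2 * q * ((P n).σ₀ * Real.log n ^ 5) ^ (q - 1) * Real.log n ≤
      (P n).lam * (P n).σ₀ := by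
  have hk : 0 < (2 * q)⁻¹ := by positivity
  filter_upwards [hlam.bound hk, h.pos, eventually_le_log 1] with n h1 h2 h3
  obtain ⟨p1, -, -, p2, p3, p4, p5⟩ := h2
  set l := Real.log n
  have hl : 0 < l := by linarith
  rw [Real.norm_of_nonneg (by positivity), Real.norm_of_nonneg p4.le] at h1
  have e1 : (l ^ 5) ^ (q - 1) * l ≤ l ^ (5 * q) := by
    calc (l ^ 5) ^ (q - 1) * l = l ^ (5 * (q - 1) + 1) := by
          rw [Real.rpow_add hl, Real.rpow_one, Real.rpow_mul hl.le]
          norm_cast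
      _ ≤ _ := Real.rpow_le_rpow_of_exponent_le h3 (by linarith)
  have e2 : (P n).σ₀ ^ (q - 1) = (P n).σ₀ ^ (q - 2) * (P n).σ₀ := by
    rw [← Real.rpow_add_one p2.ne']; ring_nf
  calc _ = 2 * q * ((P n).σ₀ ^ (q - 2) * ((l ^ 5) ^ (q - 1) * l)) * (P n).σ₀ := by
        rw [Real.mul_rpow p2.le (by positivity), e2]; ring
    _ ≤ 2 * q * ((P n).σ₀ ^ (q - 2) * l ^ (5 * q)) * (P n).σ₀ := by gcongr
    _ ≤ 2 * q * ((2 * q)⁻¹ * (P n).lam) * (P n).σ₀ := by gcongr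
    _ = _ := by field_simp

theorem AdamRegime.eventually_bounds (hq : 1 < q) (h : AdamRegime q P)
    (hlam : (fun n : ℕ => (P n).σ₀ ^ (q - 2) * Real.log n ^ (5 * q)) =o[atTop]
      fun n => (P n).lam) {C : ℝ} (hC : 0 ≤ C) :
    ∀ᶠ n : ℕ in atTop, Bounds q C (Real.log n) (P n) := by
  filter_upwards [h.pos, h.eventually_σp_le, h.B_range, eventually_le_log 5, eventually_le_log C,
    h.eventually_s_σp_le, h.eventually_η_le hq.le one_pos, h.eventually_ε_le hq.le,
    h.eventually_exp_ge hq.le, eventually_grad_le hq h hlam]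
    with n ⟨p1, p2, p3, p4, p5, p6, p7⟩ h2 h3 h4 h5 h6 h7 h8 h9 h10
  exact ⟨p1, h2, p4, p2.le, p3.le, p5, p6, p7, h3.1, h4, hC, h5, h6, by simpa using h7, h8, h9, h10⟩

/-- The number of iterations is at most polynomial in `n`. -/
theorem AdamRegime.exists_numIters_le (h : AdamRegime q P) :
    ∃ D : ℝ, ∀ᶠ n : ℕ in atTop, (numIters n (P n) : ℝ) ≤ Real.exp (D * Real.log n) := by
  obtain ⟨D₁, h1⟩ := h.T_poly.exists_le_exp
  obtain ⟨D₂, h2⟩ := h.η_inv_poly.exists_le_exp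
  refine ⟨D₁ + D₂ + 1, ?_⟩
  filter_upwards [h1, h2, h.pos, h.B_range, eventually_ge_atTop 1] with n h1 h2 h3 h4 h5
  obtain ⟨-, -, -, -, p3, -, -⟩ := h3
  have hn : (0 : ℝ) < n := by exact_mod_cast h5
  have hB : (1 : ℝ) ≤ (P n).B := by exact_mod_cast h4.1
  have hc : ((⌈(n : ℝ) / (P n).B⌉₊ : ℕ) : ℝ) ≤ n := by
    have : ⌈(n : ℝ) / (P n).B⌉₊ ≤ n := Nat.ceil_le.2 (div_le_self hn.le hB)
    exact_mod_cast this
  have hT : ((P n).T : ℝ) = (P n).T * (P n).η * (1 / (P n).η) := by field_simp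
  rw [numIters, Nat.cast_mul, hT]
  calc _ ≤ Real.exp (D₁ * Real.log n) * Real.exp (D₂ * Real.log n) * n := by gcongr
    _ = Real.exp (D₁ * Real.log n) * Real.exp (D₂ * Real.log n) * Real.exp (Real.log n) := by
        rw [Real.exp_log hn]
    _ = _ := by rw [← Real.exp_add, ← Real.exp_add]; ring_nf

/-- The union bound over polynomially many events loses to the tail `exp (-(log n)² / 2)`. -/
theorem AdamRegime.eventually_count_le (h : AdamRegime q P) :
    ∀ᶠ n : ℕ in atTop, (2 * (P n).m * (P n).d + n * (P n).d +
      (numIters n (P n) + 1) * (2 * (P n).m * n)) * (2 * Real.exp (-Real.log n ^ 2 / 2)) ≤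
        1 / (n : ℝ) := by
  obtain ⟨D₁, h1⟩ := h.d_poly.exists_le_exp
  obtain ⟨D₂, h2⟩ := h.exists_numIters_le
  set D := max (max D₁ D₂) 0
  filter_upwards [h1, h2, h.m_polylog.eventually_le_exp, eventually_ge_atTop 1,
    eventually_le_log 14, eventually_le_log (2 * D + 8)] with n h1 h2 h3 h4 h5 h6
  have hn : (0 : ℝ) < n := by exact_mod_cast h4
  set l := Real.log n with hl
  have hnl : (n : ℝ) = Real.exp l := (Real.exp_log hn).symm
  have hl0 : 0 ≤ l := by linarith
  have hd : ((P n).d : ℝ) ≤ Real.exp (D * l) := h1.trans (by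
    gcongr; exact (le_max_left _ _).trans (le_max_left _ _))
  have hN : (numIters n (P n) : ℝ) ≤ Real.exp (D * l) := h2.trans (by
    gcongr; exact (le_max_right _ _).trans (le_max_left _ _))
  have hone : 1 ≤ Real.exp (D * l) := Real.one_le_exp (mul_nonneg (le_max_right _ _) hl0)
  have hone' : 1 ≤ Real.exp l := Real.one_le_exp hl0
  set X := Real.exp (D * l)
  set Y := Real.exp l with hY
  have hY14 : 14 ≤ Y := h5.trans (le_exp_self _)
  rw [hnl]
  calc _ ≤ (2 * Y * X + Y * X + (X + X) * (2 * Y * Y)) * (2 * Real.exp (-l ^ 2 / 2)) := by gcongr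
    _ ≤ (2 * Y * X * Y + Y * X * Y + (X + X) * (2 * Y * Y)) * (2 * Real.exp (-l ^ 2 / 2)) := by
        have e1 : 2 * Y * X ≤ 2 * Y * X * Y := le_mul_of_one_le_right (by positivity) hone'
        have e2 : Y * X ≤ Y * X * Y := le_mul_of_one_le_right (by positivity) hone'
        gcongr
    _ = 14 * (X * Y * Y * Real.exp (-l ^ 2 / 2)) := by ring
    _ ≤ Y * (X * Y * Y * Real.exp (-l ^ 2 / 2)) := by gcongr
    _ = Real.exp (D * l + 3 * l - l ^ 2 / 2) := by
        have : D * l + 3 * l - l ^ 2 / 2 = l + (D * l + l + l + -l ^ 2 / 2) := by ring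
        rw [this, Real.exp_add, Real.exp_add, Real.exp_add, Real.exp_add]
    _ ≤ Real.exp (-l) := by
        gcongr
        nlinarith
    _ = 1 / Y := by rw [Real.exp_neg, one_div]

end

theorem mainTheorem5 (q : ℝ) (hq : 3 ≤ q) :
    ∃ A : ℝ, ∀ (β₁ β₂ : ℝ), 0 ≤ β₁ → β₁ < 1 → β₂ < 1 → β₁ ^ 2 < β₂ →
      ∀ P : ℕ → Params, AdamRegime q P →
        ((fun n : ℕ => (P n).σ₀ ^ (q - 2) * Real.log n ^ A) =o[atTop] fun n => (P n).lam) →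
        ∃ C D : ℝ, ∀ᶠ n : ℕ in atTop,
          ENNReal.ofReal (1 - 1 / (n : ℝ)) ≤
            trainLaw n (P n) {ω | ∀ I : ℕ → Finset (Fin n), (∀ t, (I t).card = (P n).B) →
              ∀ t ≤ numIters n (P n), ∀ (j : ℤˣ) (r : Fin (P n).m),
                |(adam q β₁ β₂ (P n) ω.1 I ω.2 t).w j r ⬝ᵥ
                    (signVal j • feature (P n).d)| ≤
                  C * Real.log n ^ D * (P n).σ₀ ∧
                ∀ i : Fin n,
                  |(adam q β₁ β₂ (P n) ω.1 I ω.2 t).w j r ⬝ᵥ (ω.1 i).noise (P n).α| ≤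
                    C * Real.log n ^ D *
                      (Real.sqrt ((P n).s : ℝ) * (P n).σp * (P n).σ₀)} := by
  refine ⟨5 * q, fun β₁ β₂ h1 h1' h2' hβ P hP hlam => ?_⟩
  have hq1 : 1 < q := by linarith
  obtain ⟨C₀, hC₀, hstuck⟩ := exists_stuck h1 h1' h2' hβ
  obtain ⟨K, D, hK, hD, hα⟩ := hP.exists_α_le
  refine ⟨3 + 2 * K, D + 4, ?_⟩
  filter_upwards [hP.eventually_bounds hq1 hlam hC₀, hα, hP.eventually_s_pos,
    hP.eventually_s_lt_d, hP.eventually_count_le] with n hb hα hs hsd hcount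
  set l := Real.log n
  have hl := hb.l_ge
  have hσp := hb.σp_pos
  have hσ₀ := hb.σ₀_pos
  have := isProbabilityMeasure_drawLaw (σ := (P n).σp) hsd
  have : IsProbabilityMeasure (trainLaw n (P n)) := by unfold trainLaw; infer_instance
  set G := {ω : (Fin n → Draw (P n).d) × Weights (P n).m (P n).d |
    GoodEvent (P n) (numIters n (P n)) (travel β₁ β₂ (P n).η) l ω.1 ω.2} with hG
  have hbad : trainLaw n (P n) Gᶜ ≤ ENNReal.ofReal (1 / n) :=
    (trainLaw_not_goodEvent_le hsd hs hσp hσ₀ (by linarith)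
      fun t => travel_nonneg h1 h1' hb.η_pos t).trans (ENNReal.ofReal_le_ofReal hcount)
  have hgood : ENNReal.ofReal (1 - 1 / (n : ℝ)) ≤ trainLaw n (P n) G := by
    rw [ENNReal.ofReal_sub _ (by positivity), ENNReal.ofReal_one, tsub_le_iff_right]
    calc 1 = trainLaw n (P n) Set.univ := measure_univ.symm
      _ = trainLaw n (P n) (G ∪ Gᶜ) := by rw [Set.union_compl_self]
      _ ≤ trainLaw n (P n) G + trainLaw n (P n) Gᶜ := measure_union_le _ _
      _ ≤ _ := by gcongr
  refine hgood.trans (measure_mono fun ω hω I hI t ht j r => ?_)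
  obtain ⟨hf, hn⟩ := hstuck hq1 hb hω I hI t ht j r
  have hl1 : 1 ≤ l := by linarith
  have hl0 : 0 < l := by linarith
  have hpow : ∀ x : ℝ, x ≤ D + 4 → l ^ x ≤ l ^ (D + 4) := fun x hx =>
    Real.rpow_le_rpow_of_exponent_le hl1 hx
  have e1 : l ≤ l ^ (D + 4) := by simpa using hpow 1 (by linarith)
  have e4 : l ^ 4 ≤ l ^ (D + 4) := by
    have := hpow (4 : ℕ) (by push_cast; linarith)
    rwa [Real.rpow_natCast] at this
  have eD : l ^ D * l ≤ l ^ (D + 4) := by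
    rw [← Real.rpow_add_one hl0.ne']
    exact hpow _ (by linarith)
  refine ⟨?_, fun i => (hn i).trans ?_⟩
  · rw [dotProduct_smul, smul_eq_mul, abs_mul, abs_signVal, one_mul]
    refine hf.trans ?_
    calc 2 * ((P n).σ₀ * l) = 2 * l * (P n).σ₀ := by ring
      _ ≤ (3 + 2 * K) * l ^ (D + 4) * (P n).σ₀ := by gcongr; linarith
  · have hsq : 1 ≤ Real.sqrt (P n).s := Real.one_le_sqrt.2 (by exact_mod_cast hs)
    set x := Real.sqrt (P n).s
    have hαx : (P n).α * (2 * ((P n).σ₀ * l)) ≤ 2 * K * l ^ (D + 4) * (x * (P n).σp * (P n).σ₀) := by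
      calc _ ≤ (K * l ^ D * (P n).σp) * (2 * ((P n).σ₀ * l)) := by gcongr
        _ = 2 * K * (l ^ D * l) * (1 * (P n).σp * (P n).σ₀) := by ring
        _ ≤ _ := by gcongr
    calc _ ≤ 3 * l ^ (D + 4) * (x * (P n).σp * (P n).σ₀) +
          2 * K * l ^ (D + 4) * (x * (P n).σp * (P n).σ₀) := by gcongr
      _ = _ := by ring
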